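/- All graphs are finite and simple. For a graph $H$ with $v$ vertices and $e$ edges put $\mathrm{free}(H)=2v-e-3$. A graph $G$ is *independent* if $\mathrm{free}(H)\ge 0$ for every subgraph $H$ of $G$ with at least two vertices, and *maximally independent* if moreover $\mathrm{free}(G)=0$. For an edge $e$ of $G$, $G/e$ is the simple graph obtained by merging the ends of $e$ (deleting $e$ and reducing double edges to single edges); $e$ is *contractible* in $G$ if $G/e$ is independent and $\mathrm{free}(G/e)=\mathrm{free}(G)$. A graph is *planar* if it has an embedding in the Euclidean plane. (Corollary 4.12) Every maximally independent planar graph $G$ with $|G|>2$ has at least three contractible edges. (Lemma 4.11) Moreover, let $G$ be an independent planar graph containing a $3$-cycle $(x,y,z)$. Then there are maximally independent subgraphs $R_{xy}$, $R_{yz}$, $R_{zx}$ of $G$ such that $x,y\in R_{xy}$, $z\notin R_{xy}$; $y,z\in R_{yz}$, $x\notin R_{yz}$; $z,x\in R_{zx}$, $y\notin R_{zx}$; each of the three subgraphs contains an edge that is contractible in $G$; and $R_{xy}\cap R_{yz}=\{y\}$, $R_{yz}\cap R_{zx}=\{z\}$, $R_{zx}\cap R_{xy}=\{x\}$. -/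

import Mathlib

namespace SimpleGraph

universe u

variable {V : Type u}

/-- The freedom number `2v - e - 3` of a (finite) graph with `v` vertices and `e` edges,
as an integer. -/
noncomputable def freedom (G : SimpleGraph V) : ℤ :=
  2 * (Nat.card V : ℤ) - (G.edgeSet.ncard : ℤ) - 3

/-- A graph is independent if all its subgraphs with at least two vertices (not necessarily
induced, and including the graph itself) have nonnegative freedom number. -/
def IsIndependent (G : SimpleGraph V) : Prop :=
  ∀ H : G.Subgraph, 2 ≤ H.verts.ncard → 0 ≤ H.coe.freedom

/-- A graph is maximally independent if it is independent and has freedom number zero. -/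
def IsMaximallyIndependent (G : SimpleGraph V) : Prop :=
  G.IsIndependent ∧ G.freedom = 0

/-- The equivalence relation on vertices that identifies the two ends of `e`, and nothing else. -/
def contractSetoid (e : Sym2 V) : Setoid V where
  r u v := u = v ∨ (u ∈ e ∧ v ∈ e)
  iseqv :=
    { refl := fun _ => Or.inl rfl
      symm := by
        rintro u v (h | ⟨h, h'⟩)
        · exact Or.inl h.symm
        · exact Or.inr ⟨h', h⟩
      trans := by
        rintro u v w (rfl | ⟨h, h'⟩) (rfl | ⟨k, k'⟩)
        · exact Or.inl rfl
        · exact Or.inr ⟨k, k'⟩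
        · exact Or.inr ⟨h, h'⟩
        · exact Or.inr ⟨h, k'⟩ }

/-- The contraction `G/e`: the ends of `e` are merged. As the result is a simple graph, the loop
coming from `e` disappears and double edges become single edges. -/
def contract (G : SimpleGraph V) (e : Sym2 V) : SimpleGraph (Quotient (contractSetoid e)) :=
  G.map (Quotient.mk (contractSetoid e))

/-- An edge `e` of `G` is contractible if `G/e` is independent and has the same freedom number
as `G`. -/
def IsContractible (G : SimpleGraph V) (e : Sym2 V) : Prop :=
  e ∈ G.edgeSet ∧ (G.contract e).IsIndependent ∧ (G.contract e).freedom = G.freedom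

/-- An embedding of a graph in the Euclidean plane: the vertices are distinct points, each edge is
a simple arc joining its ends, an arc contains no vertex other than its ends, and the arcs of two
distinct edges meet only in vertices. An edge is drawn once: its two orientations (darts)
give the same arc, traversed in opposite directions. -/
structure PlanarEmbedding (G : SimpleGraph V) where
  pos : V → EuclideanSpace ℝ (Fin 2)
  pos_injective : Function.Injective pos
  arc : ∀ d : G.Dart, _root_.Path (pos d.fst) (pos d.snd)
  arc_symm : ∀ d : G.Dart, arc d.symm = (arc d).symm
  arc_injective : ∀ d : G.Dart, Function.Injective (arc d)
  arc_vertex : ∀ (d : G.Dart) (t : unitInterval) (v : V),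
    arc d t = pos v → v = d.fst ∨ v = d.snd
  arc_inter : ∀ d d' : G.Dart, d.edge ≠ d'.edge → ∀ s t : unitInterval,
    arc d s = arc d' t → ∃ v : V, arc d s = pos v

/-- A graph is planar if it has a planar embedding. -/
def IsPlanar (G : SimpleGraph V) : Prop :=
  Nonempty G.PlanarEmbedding

end SimpleGraph

/-! Call a vertex set tight if it has at least two elements and induces a subgraph of freedom zero.
Freedom is additive over union and intersection up to the edges between A \ B and B \ A, so in an
independent graph two tight sets with two common vertices have a tight union and no such edges
(`IsTight.union`). For a triangle xyz, a blocker of xy is a tight set that contains x and y and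
avoids z. Blockers of two edges of the triangle share only one vertex, since the third edge would
join their differences (`IsBlocker.inter`). If {x, y} is the only blocker of xy, then merging x and
y loses one vertex and exactly two edges, and no freedom becomes negative
(`isContractible_of_blocker_eq`).

It remains to find a contractible edge in every maximal blocker W. If W has more than two vertices,
planarity gives a triangle abc in W. One of ab, bc has no blocker containing both x and y; a maximal
blocker of that edge is a proper subset of W, and induction on the size applies
(`exists_isContractible_of_maximal`).

The planar input is that n ≥ 3 vertices and at least 2n - 3 edges force a triangle
(`IsPlanar.exists_triangle`). A fine grid turns the embedding into a drawing by chains modulo two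
(`nonempty_model`). Closed chains of the grid are coboundaries of functions on cells, so the cycle
space of the graph consists of the coboundaries of functions on faces (`Model.exists_dual`).
Counting dimensions and face boundaries then takes the place of Euler's formula
(`card_edgeSet_le_of_dual`). -/

namespace GridPlane

open Finsupp

/-! ### Chains modulo two on the square grid -/

/-- The edges of the square grid `ℤ × ℤ`: `(g, false)` goes from `g` to the right,
`(g, true)` goes from `g` upwards. -/
abbrev Edge := (ℤ × ℤ) × Bool

/-- The second end of a grid edge (the first end of `k` is `k.1`). -/
def tgt (k : Edge) : ℤ × ℤ := if k.2 then (k.1.1, k.1.2 + 1) else (k.1.1 + 1, k.1.2)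

/-- One of the two cells at a grid edge; the other one is the cell `k.1` whose lower left
corner is `k.1`. -/
def opp (k : Edge) : ℤ × ℤ := if k.2 then (k.1.1 - 1, k.1.2) else (k.1.1, k.1.2 - 1)

/-- The boundary of a chain of grid edges modulo two. -/
noncomputable def bdry : (Edge →₀ ZMod 2) →ₗ[ZMod 2] (ℤ × ℤ →₀ ZMod 2) :=
  Finsupp.linearCombination (ZMod 2) (fun k : Edge => single k.1 1 + single (tgt k) 1)

lemma bdry_single (k : Edge) : bdry (single k 1) = single k.1 1 + single (tgt k) 1 := by
  simp [bdry]

lemma bdry_apply (c : Edge →₀ ZMod 2) (g : ℤ × ℤ) :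
    bdry c g = c (g, false) + c ((g.1 - 1, g.2), false) + c (g, true) +
      c ((g.1, g.2 - 1), true) := by
  induction c using Finsupp.induction_linear with
  | zero => simp
  | add f g hf hg => simp only [map_add, Finsupp.add_apply, hf, hg]; ring
  | single k a =>
    obtain ⟨⟨i, j⟩, b⟩ := k
    obtain ⟨i', j'⟩ := g
    have e1 : i + 1 = i' ↔ i = i' - 1 := by omega
    have e2 : j + 1 = j' ↔ j = j' - 1 := by omega
    cases b <;> simp [bdry, tgt, Finsupp.single_apply, Prod.ext_iff, e1, e2]

/-- A function on cells gives a closed chain. -/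
lemma bdry_eq_zero {c : Edge →₀ ZMod 2} {x : ℤ × ℤ → ZMod 2}
    (h : ∀ k, c k = x k.1 + x (opp k)) : bdry c = 0 := by
  ext ⟨i, j⟩
  have h2 : (2 : ZMod 2) = 0 := rfl
  rw [bdry_apply]
  simp only [h, opp, Finsupp.zero_apply]
  simp only [Bool.false_eq_true, if_false, if_true]
  -- Each of the four cells at a grid point borders two of the four edges there.
  linear_combination (x (i, j) + x (i, j - 1) + x (i - 1, j) + x (i - 1, j - 1)) * h2

/-- Every closed chain comes from a function on cells. -/
lemma exists_of_bdry_eq_zero {c : Edge →₀ ZMod 2} (h : bdry c = 0) :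
    ∃ x : ℤ × ℤ → ZMod 2, ∀ k, c k = x k.1 + x (opp k) := by
  obtain ⟨N, hN⟩ : ∃ N : ℤ, ∀ k : Edge, N < k.1.2 → c k = 0 := by
    obtain ⟨N, hN⟩ := (c.support.image (fun k : Edge => k.1.2)).bddAbove
    refine ⟨N, fun k hk => ?_⟩
    by_contra hc
    exact absurd (hN (Finset.mem_coe.2 (Finset.mem_image_of_mem _ (Finsupp.mem_support_iff.2 hc))))
      (not_le.2 hk)
  have h2 : (2 : ZMod 2) = 0 := rfl
  have hd : ∀ i j, c ((i, j), false) + c ((i - 1, j), false) + c ((i, j), true) +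
      c ((i, j - 1), true) = 0 := fun i j => by
    rw [← bdry_apply c (i, j), h]; rfl
  -- The parity of the crossings of `c` with the upward vertical ray from the cell; the sum is
  -- finite because `c` vanishes above row `N`.
  let s : ℤ → ℤ → ZMod 2 := fun i j => ∑ k ∈ Finset.Ioc j N, c ((i, k), false)
  have hs : ∀ i j, s i (j - 1) = c ((i, j), false) + s i j := by
    intro i j
    by_cases hj : j ≤ N
    · have : Finset.Ioc (j - 1) N = insert j (Finset.Ioc j N) := by ext; simp; omega
      simp only [s]
      rw [this, Finset.sum_insert (by simp)]
    · have e1 : Finset.Ioc (j - 1) N = ∅ := Finset.Ioc_eq_empty (by omega)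
      have e2 : Finset.Ioc j N = ∅ := Finset.Ioc_eq_empty (by omega)
      simp only [s]
      rw [e1, e2, hN ((i, j), false) (by simpa using hj)]; simp
  -- Downward induction on the row, starting above the support: closedness at `(i, j + 1)`
  -- determines the vertical edge below that point.
  have hv : ∀ n : ℕ, ∀ i j, N - j ≤ n → c ((i, j), true) = s i j + s (i - 1) j := by
    intro n
    induction n with
    | zero =>
      intro i j hj
      have e2 : Finset.Ioc j N = ∅ := Finset.Ioc_eq_empty (by push_cast at hj; omega)
      have e0 : c ((i, j + 1), true) = 0 := hN _ (by push_cast at hj; simp; omega)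
      have e1 := hd i (j + 1)
      rw [hN ((i, j + 1), false) (by push_cast at hj; simp; omega),
        hN ((i - 1, j + 1), false) (by push_cast at hj; simp; omega), e0] at e1
      simp only [s]
      rw [e2]
      simpa using e1
    | succ n ih =>
      intro i j hj
      have e0 := ih i (j + 1) (by push_cast at hj; omega)
      have e1 := hd i (j + 1)
      have e3 := hs i (j + 1)
      have e4 := hs (i - 1) (j + 1)
      simp only [add_sub_cancel_right] at e1 e3 e4
      rw [e3, e4]
      linear_combination e1 - e0 - (c ((i, j + 1), false) + c ((i - 1, j + 1), false) +
        s i (j + 1) + s (i - 1) (j + 1)) * h2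
  refine ⟨fun g => s g.1 g.2, fun ⟨⟨i, j⟩, b⟩ => ?_⟩
  cases b
  · simp only [opp, Bool.false_eq_true, if_false]
    rw [hs]
    linear_combination - s i j * h2
  · simp only [opp, if_true]
    exact hv (N - j).toNat i j (Int.self_le_toNat _)

/-! ### Drawings in the grid and their algebraic duals -/

open Classical in
/-- The number of ends of `k` in `A`, modulo two. -/
noncomputable def cut (A : Set (ℤ × ℤ)) (k : Edge) : ZMod 2 :=
  (if k.1 ∈ A then 1 else 0) + (if tgt k ∈ A then 1 else 0)

/-- Summation by parts: the sum is the pairing of `bdry c` with the indicator function of `A`. So a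
closed chain leaves any region an even number of times. -/
lemma sum_cut_eq_zero (A : Set (ℤ × ℤ)) {c : Edge →₀ ZMod 2} (h : bdry c = 0) :
    c.sum (fun k a => a * cut A k) = 0 := by
  classical
  let t : (ℤ × ℤ →₀ ZMod 2) →ₗ[ZMod 2] ZMod 2 :=
    Finsupp.linearCombination (ZMod 2) (fun g => if g ∈ A then (1 : ZMod 2) else 0)
  have : ∀ c : Edge →₀ ZMod 2, t (bdry c) = c.sum (fun k a => a * cut A k) := by
    intro c
    have : bdry c = ∑ k ∈ c.support, c k • (single k.1 1 + single (tgt k) 1) := by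
      rw [bdry, Finsupp.linearCombination_apply, Finsupp.sum]
    rw [this, map_sum, Finsupp.sum]
    simp [t, cut, mul_add]
  rw [← this, h, map_zero]

/-- A drawing of `G` in the square grid modulo two. Each edge `e` is a chain `D e` joining the
base points of its ends, with a distinguished grid edge `h e` that leaves the regions `A v` of
the ends of `e`, while no other grid edge of the drawing leaves a region. -/
structure Model {V : Type*} (G : SimpleGraph V) where
  A : V → Set (ℤ × ℤ)
  p : V → ℤ × ℤ
  h : G.edgeSet → Edge
  D : G.edgeSet → (Edge →₀ ZMod 2)
  bdry_D : ∀ (e : G.edgeSet) u v, (e : Sym2 V) = s(u, v) → bdry (D e) = single (p u) 1 + single (p v) 1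
  D_h : ∀ e, D e (h e) = 1
  cut_h : ∀ (e : G.edgeSet) v, cut (A v) (h e) ≠ 0 ↔ v ∈ (e : Sym2 V)
  cut_D : ∀ e k, D e k ≠ 0 → k = h e ∨ ∀ v, cut (A v) k = 0

open Classical in
/-- A function on edges is a cycle modulo two. -/
def IsCycleMod2 {V : Type*} [Fintype V] (G : SimpleGraph V) (z : G.edgeSet → ZMod 2) : Prop :=
  ∀ v, ∑ e : G.edgeSet, (if v ∈ (e : Sym2 V) then z e else 0) = 0

namespace Model

variable {V : Type*} {G : SimpleGraph V} (m : Model G)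

lemma h_injective : Function.Injective m.h := by
  intro e e' h
  refine Subtype.ext (Sym2.ext fun v => ?_)
  rw [← m.cut_h, ← m.cut_h, h]

/-- The grid edge `m.h e'` leaves the regions of the ends of `e'`, so `cut_D` lets another chain use
it only as its own distinguished edge. -/
lemma D_h_of_ne {e e' : G.edgeSet} (h : e ≠ e') : m.D e (m.h e') = 0 := by
  by_contra hc
  rcases m.cut_D e _ hc with h1 | h1
  · exact h (m.h_injective h1).symm
  · obtain ⟨v, hv⟩ : ∃ v, v ∈ (e' : Sym2 V) := ⟨_, Sym2.out_fst_mem _⟩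
    exact (m.cut_h e' v).2 hv (h1 v)

open Classical in
lemma bdry_D_eq [Fintype V] (e : G.edgeSet) :
    bdry (m.D e) = ∑ v, if v ∈ (e : Sym2 V) then single (m.p v) 1 else 0 := by
  obtain ⟨e, he⟩ := e
  induction e with
  | h u v =>
    rw [m.bdry_D _ u v rfl, ← Finset.sum_filter]
    have : (Finset.univ.filter fun w => w ∈ s(u, v)) = {u, v} := by ext; simp
    rw [this, Finset.sum_pair (G.ne_of_adj he)]

/-- Grid edges that the drawing does not use. -/
def Free (a b : ℤ × ℤ) : Prop := ∃ k : Edge, (∀ e, m.D e k = 0) ∧ a = k.1 ∧ b = opp k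

/-- Algebraic duality: for suitable faces, the cycles of a graph drawn in the grid are the
coboundaries of functions on faces. -/
theorem exists_dual (m : Model G) [Fintype V] :
    ∃ (Φ : Type) (l r : G.edgeSet → Φ), ∀ z : G.edgeSet → ZMod 2,
      IsCycleMod2 G z ↔ ∃ x : Φ → ZMod 2, ∀ e, z e = x (l e) + x (r e) := by
  classical
  -- A face is a class of cells connected across unused grid edges; `l` and `r` give the faces on
  -- the two sides of `m.h e`.
  refine ⟨Quot m.Free, fun e => Quot.mk _ (m.h e).1, fun e => Quot.mk _ (opp (m.h e)),
    fun z => ⟨fun hz => ?_, ?_⟩⟩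
  -- Draw the cycle as a closed chain and write it as the coboundary of a function on cells. That
  -- function does not change across unused edges, so it descends to faces, and its jump at `m.h e`
  -- is `z e`.
  · let c : Edge →₀ ZMod 2 := ∑ e, z e • m.D e
    have hc : bdry c = 0 := by
      simp only [c, map_sum, map_smul, m.bdry_D_eq, Finset.smul_sum]
      rw [Finset.sum_comm]
      refine Finset.sum_eq_zero fun v _ => ?_
      have : ∀ e : G.edgeSet, (z e • if v ∈ (e : Sym2 V) then single (m.p v) (1 : ZMod 2) else 0) =
          (if v ∈ (e : Sym2 V) then z e else 0) • single (m.p v) (1 : ZMod 2) := by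
        intro e; split_ifs <;> simp
      simp only [this]
      rw [← Finset.sum_smul, hz v, zero_smul]
    obtain ⟨x, hx⟩ := exists_of_bdry_eq_zero hc
    refine ⟨Quot.lift x ?_, fun e => ?_⟩
    · rintro _ _ ⟨k, hk, rfl, rfl⟩
      have := hx k
      rw [show c k = 0 by simp [c, hk]] at this
      exact CharTwo.add_eq_zero.1 this.symm
    · change z e = x (m.h e).1 + x (opp (m.h e))
      rw [← hx]
      simp only [c, Finsupp.finsetSum_apply, Finsupp.smul_apply, smul_eq_mul]
      rw [Finset.sum_eq_single e, m.D_h, mul_one]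
      · intro e' _ h; rw [m.D_h_of_ne h, mul_zero]
      · simp
  · rintro ⟨x, hx⟩ v
    -- Conversely, the coboundary of a function on faces is a closed chain supported on the drawing.
    -- There only the `m.h e` with `v ∈ e` leave `A v`, so the parity of the exits from `A v` is the
    -- cycle condition at `v`.
    let S : Finset Edge := Finset.univ.biUnion fun e => (m.D e).support
    let y : Edge → ZMod 2 := fun k => x (Quot.mk _ k.1) + x (Quot.mk _ (opp k))
    have hy : ∀ k, y k ≠ 0 → k ∈ S := by
      intro k hk
      by_contra hS
      have hS : ∀ e, m.D e k = 0 := by simpa [S] using hS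
      refine hk ?_
      simp only [y]
      rw [Quot.sound (⟨k, hS, rfl, rfl⟩ : m.Free k.1 (opp k))]
      exact CharTwo.add_self_eq_zero _
    let c : Edge →₀ ZMod 2 := Finsupp.onFinset S y hy
    have hc : bdry c = 0 := bdry_eq_zero (x := fun g => x (Quot.mk _ g)) fun k => rfl
    have := sum_cut_eq_zero (m.A v) hc
    rw [Finsupp.sum_of_support_subset c (s := S) Finsupp.support_onFinset_subset _ (by simp)] at this
    have hS : ∑ k ∈ S, c k * cut (m.A v) k =
        ∑ k ∈ Finset.univ.image m.h, c k * cut (m.A v) k := by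
      symm
      refine Finset.sum_subset ?_ ?_
      · intro k hk
        obtain ⟨e, -, rfl⟩ := Finset.mem_image.1 hk
        simp only [S, Finset.mem_biUnion, Finset.mem_univ, true_and, Finsupp.mem_support_iff]
        exact ⟨e, by simp [m.D_h]⟩
      · intro k hk hk'
        simp only [S, Finset.mem_biUnion, Finset.mem_univ, true_and,
          Finsupp.mem_support_iff] at hk
        obtain ⟨e, he⟩ := hk
        rcases m.cut_D e k he with rfl | h
        · simp at hk'
        · rw [h, mul_zero]
    rw [hS, Finset.sum_image fun _ _ _ _ h => m.h_injective h] at this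
    refine Eq.trans (Finset.sum_congr rfl fun e _ => ?_) this
    have h1 : c (m.h e) = z e := (hx e).symm
    rw [h1]
    have h01 : ∀ a : ZMod 2, a ≠ 0 → a = 1 := by decide
    split_ifs with hv
    · rw [h01 _ ((m.cut_h e v).2 hv), mul_one]
    · rw [not_not.1 (mt (m.cut_h e v).1 hv), mul_zero]

end Model

/-! ### Counting edges of triangle-free graphs with a dual -/

section Count

variable {V : Type*} [Fintype V] {G : SimpleGraph V}

lemma IsCycleMod2.exists_ne {z : G.edgeSet → ZMod 2} (hz : IsCycleMod2 G z) {e : G.edgeSet}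
    {v : V} (hv : v ∈ (e : Sym2 V)) (he : z e ≠ 0) :
    ∃ e' : G.edgeSet, e' ≠ e ∧ v ∈ (e' : Sym2 V) ∧ z e' ≠ 0 := by
  classical
  by_contra! hc
  have := hz v
  rw [Finset.sum_eq_single e] at this
  · simp [hv, he] at this
  · intro e' _ hne
    split_ifs with h
    · exact hc e' hne h
    · rfl
  · simp

open Classical in
/-- A nonzero cycle of a triangle-free graph has at least four edges. -/
lemma IsCycleMod2.four_le (hG : ∀ a b c, G.Adj a b → G.Adj b c → ¬ G.Adj c a)
    {z : G.edgeSet → ZMod 2} (hz : IsCycleMod2 G z) (h0 : z ≠ 0) :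
    4 ≤ (Finset.univ.filter fun e => z e ≠ 0).card := by
  have next : ∀ u v (h : G.Adj u v), z ⟨s(u, v), h⟩ ≠ 0 →
      ∃ w, w ≠ v ∧ ∃ h' : G.Adj u w, z ⟨s(u, w), h'⟩ ≠ 0 := by
    intro u v h hne
    obtain ⟨⟨e', he'⟩, hne', hu, hze⟩ := hz.exists_ne (v := u) (by simp) hne
    obtain ⟨w, rfl⟩ := Sym2.mem_iff_exists.1 hu
    refine ⟨w, ?_, he', hze⟩
    rintro rfl
    exact hne' rfl
  have sw : ∀ u v (h : G.Adj u v), z ⟨s(u, v), h⟩ ≠ 0 → z ⟨s(v, u), h.symm⟩ ≠ 0 := by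
    intro u v h hne
    have : (⟨s(v, u), h.symm⟩ : G.edgeSet) = ⟨s(u, v), h⟩ := Subtype.ext Sym2.eq_swap
    rwa [this]
  obtain ⟨⟨e, he⟩, hze⟩ := Function.ne_iff.1 h0
  induction e with
  | h u v =>
    -- The support contains a path w, u, v, v' and a further edge from w to w'. Without triangles
    -- these four edges are distinct; w' = v' is allowed.
    obtain ⟨w, hwv, huw, zuw⟩ := next u v he hze
    obtain ⟨v', hv', hvv', zvv'⟩ := next v u he.symm (sw _ _ _ hze)
    obtain ⟨w', hw', hww', zww'⟩ := next w u huw.symm (sw _ _ _ zuw)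
    have huv : G.Adj u v := he
    have hnw : v' ≠ w := by
      rintro rfl; exact hG u v v' huv hvv' huw.symm
    have hnv : w' ≠ v := by
      rintro rfl; exact hG u w w' huw hww' huv.symm
    have n1 := huv.ne
    have n2 := huw.ne
    have n3 := hvv'.ne
    have n4 := hww'.ne
    let F : Finset G.edgeSet := {⟨s(u, v), he⟩, ⟨s(u, w), huw⟩, ⟨s(v, v'), hvv'⟩, ⟨s(w, w'), hww'⟩}
    have hF : F.card = 4 := by
      simp only [F]
      rw [Finset.card_insert_of_notMem, Finset.card_insert_of_notMem,
        Finset.card_insert_of_notMem, Finset.card_singleton]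
      all_goals
        simp [Subtype.ext_iff, n1, n2, n3, n4, n1.symm, hnw, hnw.symm, hnv.symm, hwv, hwv.symm,
          hv'.symm, hw'.symm]
    rw [← hF]
    refine Finset.card_le_card fun e he => ?_
    simp only [F, Finset.mem_insert, Finset.mem_singleton] at he
    simp only [Finset.mem_filter, Finset.mem_univ, true_and]
    rcases he with rfl | rfl | rfl | rfl <;> assumption

open Classical in
/-- The incidence map modulo two. -/
noncomputable def incidence (G : SimpleGraph V) :
    (G.edgeSet → ZMod 2) →ₗ[ZMod 2] (V → ZMod 2) where
  toFun z v := ∑ e : G.edgeSet, (if v ∈ (e : Sym2 V) then z e else 0)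
  map_add' z w := by
    ext v
    simp only [Pi.add_apply, ← Finset.sum_add_distrib]
    exact Finset.sum_congr rfl fun e _ => by split_ifs <;> simp
  map_smul' a z := by
    ext v
    simp only [Pi.smul_apply, RingHom.id_apply, smul_eq_mul, Finset.mul_sum]
    exact Finset.sum_congr rfl fun e _ => by split_ifs <;> simp

lemma mem_ker_incidence {z : G.edgeSet → ZMod 2} :
    z ∈ LinearMap.ker (incidence G) ↔ IsCycleMod2 G z := by
  rw [LinearMap.mem_ker, funext_iff]; rfl

open Classical in
/-- The cycle space has dimension at least `e - n + 1`. -/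
lemma card_edgeSet_lt [Nonempty V] : Fintype.card G.edgeSet <
    Module.finrank (ZMod 2) (LinearMap.ker (incidence G)) + Fintype.card V := by
  let t : (V → ZMod 2) →ₗ[ZMod 2] ZMod 2 := ∑ v, LinearMap.proj v
  have ht : ∀ y, t y = ∑ v, y v := fun y => by simp [t]
  -- Each edge has two ends, so the range lies in a hyperplane and the rank is at most `n - 1`.
  have hr : LinearMap.range (incidence G) ≤ LinearMap.ker t := by
    rintro _ ⟨z, rfl⟩
    rw [LinearMap.mem_ker, ht]
    change ∑ v, ∑ e : G.edgeSet, (if v ∈ (e : Sym2 V) then z e else 0) = 0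
    rw [Finset.sum_comm]
    refine Finset.sum_eq_zero fun ⟨e, he⟩ _ => ?_
    induction e with
    | h u v =>
      rw [← Finset.sum_filter]
      have : (Finset.univ.filter fun w => w ∈ s(u, v)) = {u, v} := by ext; simp
      simp only [this]
      rw [Finset.sum_pair (G.ne_of_adj he)]
      exact CharTwo.add_self_eq_zero _
  have hs : LinearMap.range t = ⊤ := by
    refine LinearMap.range_eq_top.2 fun a => ⟨Pi.single (Classical.arbitrary V) a, ?_⟩
    rw [ht]; simp
  have h1 := LinearMap.finrank_range_add_finrank_ker t
  have h2 := LinearMap.finrank_range_add_finrank_ker (incidence G)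
  have h3 := Submodule.finrank_mono hr
  rw [hs, finrank_top] at h1
  simp only [Module.finrank_self, Module.finrank_fintype_fun_eq_card] at h1 h2
  omega

open Classical in
/-- A graph that has an algebraic dual and no triangles satisfies `e ≤ 2n - 4`, unless it has
fewer edges than vertices. -/
theorem card_edgeSet_le_of_dual [Nonempty V] (hG : ∀ a b c, G.Adj a b → G.Adj b c → ¬ G.Adj c a)
    {Φ : Type*} (l r : G.edgeSet → Φ)
    (hd : ∀ z : G.edgeSet → ZMod 2,
      IsCycleMod2 G z ↔ ∃ x : Φ → ZMod 2, ∀ e, z e = x (l e) + x (r e))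
    (hn : Fintype.card V ≤ Fintype.card G.edgeSet) :
    Fintype.card G.edgeSet + 4 ≤ 2 * Fintype.card V := by
  -- The boundary of a face; an edge with the same face on both sides contributes zero.
  let b : Φ → G.edgeSet → ZMod 2 := fun f e =>
    (if l e = f then 1 else 0) + (if r e = f then 1 else 0)
  let F : Finset Φ := Finset.univ.image l ∪ Finset.univ.image r
  let P : Finset Φ := F.filter fun f => b f ≠ 0
  have hbZ : ∀ f, IsCycleMod2 G (b f) := fun f =>
    (hd _).2 ⟨fun f' => if f' = f then 1 else 0, fun e => rfl⟩
  have hexp : ∀ x : Φ → ZMod 2, (fun e => x (l e) + x (r e)) = ∑ f ∈ P, x f • b f := by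
    intro x
    have : ∑ f ∈ P, x f • b f = ∑ f ∈ F, x f • b f := by
      refine Finset.sum_subset (Finset.filter_subset _ _) fun f hf hfP => ?_
      have : b f = 0 := by
        by_contra h; exact hfP (Finset.mem_filter.2 ⟨hf, h⟩)
      rw [this, smul_zero]
    rw [this]
    ext e
    have hl : l e ∈ F := by simp [F]
    have hr : r e ∈ F := by simp [F]
    simp only [b, Finset.sum_apply, Pi.smul_apply, smul_eq_mul, mul_add, Finset.sum_add_distrib,
      mul_ite, mul_one, mul_zero, Finset.sum_ite_eq, hl, hr, if_true]
  have hsum : ∑ f ∈ P, b f = 0 := by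
    have h : (fun _ => 1 + 1) = ∑ f ∈ P, (1 : ZMod 2) • b f := hexp fun _ => 1
    simp only [one_smul] at h
    rw [← h]
    ext e
    exact CharTwo.add_self_eq_zero _
  have hdim := card_edgeSet_lt (G := G)
  have hspan : LinearMap.ker (incidence G) ≤ Submodule.span (ZMod 2) (b '' P) := by
    intro z hz
    obtain ⟨x, hx⟩ := (hd z).1 (mem_ker_incidence.1 hz)
    rw [show z = _ from (funext hx).trans (hexp x)]
    exact Submodule.sum_mem _ fun f hf =>
      Submodule.smul_mem _ _ (Submodule.subset_span ⟨f, hf, rfl⟩)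
  -- By `hn` the cycle space is nonzero, so some face has a nonzero boundary. It is redundant as a
  -- generator, because all boundaries sum to zero.
  obtain ⟨f0, hf0⟩ : P.Nonempty := by
    rw [Finset.nonempty_iff_ne_empty]
    intro h
    have hbot : LinearMap.ker (incidence G) = ⊥ := by
      rw [h] at hspan
      simpa only [Finset.coe_empty, Set.image_empty, Submodule.span_empty, le_bot_iff] using hspan
    rw [hbot, finrank_bot] at hdim
    omega
  have hspan' : Submodule.span (ZMod 2) (b '' P) ≤
      Submodule.span (ZMod 2) (((P.erase f0).image b : Finset _) : Set (G.edgeSet → ZMod 2)) := by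
    rw [Submodule.span_le]
    rintro _ ⟨f, hf, rfl⟩
    by_cases hff : f = f0
    · rw [hff]
      have h1 := Finset.add_sum_erase P b hf0
      rw [hsum] at h1
      have h2 : b f0 = ∑ g ∈ P.erase f0, b g := by
        rw [← sub_eq_zero, ← h1]
        ext e
        simp only [Pi.sub_apply, Pi.add_apply]
        exact CharTwo.sub_eq_add _ _
      rw [h2]
      exact Submodule.sum_mem _ fun g hg =>
        Submodule.subset_span (Finset.mem_coe.2 (Finset.mem_image_of_mem _ hg))
    · exact Submodule.subset_span (Finset.mem_coe.2 (Finset.mem_image_of_mem _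
        (Finset.mem_erase.2 ⟨hff, hf⟩)))
  have h5 : Module.finrank (ZMod 2) (LinearMap.ker (incidence G)) ≤ P.card - 1 :=
    (Submodule.finrank_mono (hspan.trans hspan')).trans <|
      (finrank_span_finset_le_card _).trans <| Finset.card_image_le.trans
        (Finset.card_erase_of_mem hf0).le
  have hP : 0 < P.card := Finset.card_pos.2 ⟨f0, hf0⟩
  -- Double counting: a nonzero face boundary has at least four edges, and an edge lies in at most
  -- two boundaries.
  have h6 : P.card * 4 ≤ Fintype.card G.edgeSet * 2 := by
    refine Finset.card_mul_le_card_mul (fun f e => b f e ≠ 0) (s := P) (t := Finset.univ)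
      (fun f hf => (hbZ f).four_le hG (Finset.mem_filter.1 hf).2) fun e _ => ?_
    refine (Finset.card_le_card (t := {l e, r e}) fun f hf => ?_).trans Finset.card_le_two
    have := (Finset.mem_filter.1 hf).2
    by_contra hc
    simp only [Finset.mem_insert, Finset.mem_singleton, not_or] at hc
    exact this (by simp [b, Ne.symm hc.1, Ne.symm hc.2])
  omega

end Count

end GridPlane

/-! ### From discrete regions to a drawing in the grid -/

namespace GridPlane

open Finsupp

/-- Neighbouring points of the grid. -/
def Near (g g' : ℤ × ℤ) : Prop := ∃ k : Edge, (k.1 = g ∧ tgt k = g') ∨ (k.1 = g' ∧ tgt k = g)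

/-- Reachability by grid steps inside `N`. -/
def Reach (N : Set (ℤ × ℤ)) : ℤ × ℤ → ℤ × ℤ → Prop :=
  Relation.ReflTransGen fun g g' => Near g g' ∧ g ∈ N ∧ g' ∈ N

/-- `g` and `g'` are joined by a chain of edges inside `A`. -/
def Joined (A : Set (ℤ × ℤ)) (g g' : ℤ × ℤ) : Prop :=
  ∃ c : Edge →₀ ZMod 2, bdry c = single g 1 + single g' 1 ∧ ∀ k, c k ≠ 0 → k.1 ∈ A ∧ tgt k ∈ A

lemma add_self_zmod2 (f : ℤ × ℤ →₀ ZMod 2) : f + f = 0 := by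
  ext g; exact CharTwo.add_self_eq_zero _

lemma add_add_cancel_zmod2 (f g h : ℤ × ℤ →₀ ZMod 2) : f + g + (g + h) = f + h := by
  rw [add_assoc, ← add_assoc g, add_self_zmod2, zero_add]

lemma Joined.refl (A : Set (ℤ × ℤ)) (g : ℤ × ℤ) : Joined A g g :=
  ⟨0, by rw [map_zero, add_self_zmod2], by simp⟩

lemma bdry_of_ends {k : Edge} {g g' : ℤ × ℤ}
    (h : (k.1 = g ∧ tgt k = g') ∨ (k.1 = g' ∧ tgt k = g)) :
    bdry (single k 1) = single g 1 + single g' 1 := by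
  rw [bdry_single]
  rcases h with ⟨rfl, rfl⟩ | ⟨rfl, rfl⟩
  · rfl
  · rw [add_comm]

lemma Joined.step {A : Set (ℤ × ℤ)} {a g g' : ℤ × ℤ} (h : Joined A a g) (hn : Near g g')
    (hg : g ∈ A) (hg' : g' ∈ A) : Joined A a g' := by
  obtain ⟨c, hc, hcA⟩ := h
  obtain ⟨k, hk⟩ := hn
  refine ⟨c + single k 1, ?_, fun l hl => ?_⟩
  · rw [map_add, hc, bdry_of_ends hk, add_add_cancel_zmod2]
  · by_cases hlk : l = k
    · subst hlk
      rcases hk with ⟨h1, h2⟩ | ⟨h1, h2⟩ <;> rw [h1, h2] <;> exact ⟨by assumption, by assumption⟩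
    · refine hcA l fun h0 => hl ?_
      rw [Finsupp.add_apply, h0, Finsupp.single_eq_of_ne hlk, add_zero]

lemma Reach.joined {N A : Set (ℤ × ℤ)} (hN : N ⊆ A) {g g' : ℤ × ℤ} (h : Reach N g g') :
    Joined A g g' := by
  induction h with
  | refl => exact Joined.refl A g
  | tail _ h ih => exact ih.step h.1 (hN h.2.1) (hN h.2.2)

lemma cut_ne_zero_iff {A : Set (ℤ × ℤ)} {k : Edge} : cut A k ≠ 0 ↔ ¬ (k.1 ∈ A ↔ tgt k ∈ A) := by
  by_cases h1 : k.1 ∈ A <;> by_cases h2 : tgt k ∈ A <;>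
    simp [cut, h1, h2, CharTwo.add_self_eq_zero]

lemma cut_of_inside {A B : Set (ℤ × ℤ)} (hd : A = B ∨ Disjoint A B) {k : Edge}
    (h1 : k.1 ∈ A) (h2 : tgt k ∈ A) : cut B k = 0 := by
  rcases hd with rfl | hd
  · simp [cut, h1, h2, CharTwo.add_self_eq_zero]
  · simp [cut, Set.disjoint_left.1 hd h1, Set.disjoint_left.1 hd h2]

/-- Discrete regions for the vertices and the edges of `G` give a drawing of `G` in the grid. -/
theorem exists_model_of_regions {V : Type*} {G : SimpleGraph V} (N : V → Set (ℤ × ℤ))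
    (Q : G.edgeSet → Set (ℤ × ℤ)) (hNe : ∀ v, (N v).Nonempty)
    (hN : ∀ v, ∀ g ∈ N v, ∀ g' ∈ N v, Reach (N v) g g')
    (hQ : ∀ e, ∀ g ∈ Q e, ∀ g' ∈ Q e, Reach (Q e) g g')
    (hNN : ∀ u v, u ≠ v → Disjoint (N u) (N v)) (hQQ : ∀ e f, e ≠ f → Disjoint (Q e) (Q f))
    (hNQ : ∀ (e : G.edgeSet) v, v ∉ (e : Sym2 V) → Disjoint (N v) (Q e))
    (hmeet : ∀ (e : G.edgeSet) v, v ∈ (e : Sym2 V) → (N v ∩ Q e).Nonempty) :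
    Nonempty (Model G) := by
  choose p hp using hNe
  have hends : ∀ e : G.edgeSet, ∃ u v, (e : Sym2 V) = s(u, v) := fun ⟨e, _⟩ => by
    induction e with
    | h u v => exact ⟨u, v, rfl⟩
  choose tl hd hth using hends
  have hne : ∀ e, tl e ≠ hd e := fun e h => G.ne_of_adj (show G.Adj (tl e) (hd e) by
    rw [← SimpleGraph.mem_edgeSet, ← hth]; exact e.2) h
  -- The region of each edge, outside the region of its head, is given to its tail. The chain of the
  -- edge then needs to change regions only once.
  let A : V → Set (ℤ × ℤ) := fun w => N w ∪ {g | ∃ e, tl e = w ∧ g ∈ Q e ∧ g ∉ N (hd e)}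
  have hNA : ∀ w, N w ⊆ A w := fun w => Set.subset_union_left
  have haux : ∀ u v, u ≠ v → ∀ g ∈ N u, ∀ e, tl e = v → g ∈ Q e → g ∉ N (hd e) → False := by
    intro u v huv g hg e he hgQ hgN
    by_cases hue : u = hd e
    · exact hgN (hue ▸ hg)
    · refine Set.disjoint_left.1 (hNQ e u ?_) hg hgQ
      rw [hth e, Sym2.mem_iff, he]
      exact not_or.2 ⟨huv, hue⟩
  have hAA : ∀ u v, u ≠ v → Disjoint (A u) (A v) := by
    intro u v huv
    rw [Set.disjoint_left]
    rintro g (hg | ⟨e, he, hgQ, hgN⟩) (hg' | ⟨f, hf, hgQ', hgN'⟩)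
    · exact Set.disjoint_left.1 (hNN u v huv) hg hg'
    · exact haux u v huv g hg f hf hgQ' hgN'
    · exact haux v u huv.symm g hg' e he hgQ hgN
    · refine Set.disjoint_left.1 (hQQ e f ?_) hgQ hgQ'
      rintro rfl
      exact huv (he.symm.trans hf)
  have hAA' : ∀ u v, A u = A v ∨ Disjoint (A u) (A v) := fun u v => by
    by_cases h : u = v
    · exact Or.inl (h ▸ rfl)
    · exact Or.inr (hAA u v h)
  -- This is the first entry into `N (hd e)` of a walk in `Q e` that starts in `N (tl e)`. As `A (tl
  -- e)` may be disconnected, the link to the base point is carried along.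
  have key : ∀ e, ∃ a b, Near a b ∧ a ∈ A (tl e) ∧ Joined (A (tl e)) (p (tl e)) a ∧
      b ∈ N (hd e) := by
    intro e
    by_contra! hc
    obtain ⟨g, hg, hgQ⟩ := hmeet e (tl e) (by rw [hth e]; simp)
    obtain ⟨g', hg', hgQ'⟩ := hmeet e (hd e) (by rw [hth e]; simp)
    have : ∀ x, Reach (Q e) g x →
        x ∉ N (hd e) ∧ x ∈ A (tl e) ∧ Joined (A (tl e)) (p (tl e)) x := by
      intro x hx
      induction hx with
      | refl =>
        exact ⟨Set.disjoint_left.1 (hNN _ _ (hne e)) hg, hNA _ hg,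
          (hN _ _ (hp _) _ hg).joined (hNA _)⟩
      | tail _ h ih =>
        have h1 := hc _ _ h.1 ih.2.1 ih.2.2
        have h2 : _ ∈ A (tl e) := Or.inr ⟨e, rfl, h.2.2, h1⟩
        exact ⟨h1, h2, ih.2.2.step h.1 ih.2.1 h2⟩
    exact (this g' (hQ e g hgQ g' hgQ')).1 hg'
  have key' : ∀ e : G.edgeSet, ∃ (k : Edge) (c c' : Edge →₀ ZMod 2) (a b : ℤ × ℤ),
      ((k.1 = a ∧ tgt k = b) ∨ (k.1 = b ∧ tgt k = a)) ∧ a ∈ A (tl e) ∧ b ∈ A (hd e) ∧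
      bdry c = single (p (tl e)) 1 + single a 1 ∧
      (∀ k, c k ≠ 0 → k.1 ∈ A (tl e) ∧ tgt k ∈ A (tl e)) ∧
      bdry c' = single b 1 + single (p (hd e)) 1 ∧
      (∀ k, c' k ≠ 0 → k.1 ∈ A (hd e) ∧ tgt k ∈ A (hd e)) := by
    intro e
    obtain ⟨a, b, ⟨k, hk⟩, ha, ⟨c, hc, hcA⟩, hb⟩ := key e
    obtain ⟨c', hc', hcA'⟩ := (hN _ _ hb _ (hp (hd e))).joined (hNA _)
    exact ⟨k, c, c', a, b, hk, ha, hNA _ hb, hc, hcA, hc', hcA'⟩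
  choose h c c' a b hk ha hb hc hcA hc' hcA' using key'
  have hout : ∀ e v, ¬ ((h e).1 ∈ A v ∧ tgt (h e) ∈ A v) := by
    rintro e v ⟨h1, h2⟩
    have hab : a e ∈ A v ∧ b e ∈ A v := by
      rcases hk e with ⟨h3, h4⟩ | ⟨h3, h4⟩ <;> rw [h3] at h1 <;> rw [h4] at h2
      exacts [⟨h1, h2⟩, ⟨h2, h1⟩]
    have e1 : tl e = v := by
      by_contra hv; exact Set.disjoint_left.1 (hAA _ _ hv) (ha e) hab.1
    have e2 : hd e = v := by
      by_contra hv; exact Set.disjoint_left.1 (hAA _ _ hv) (hb e) hab.2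
    exact hne e (e1.trans e2.symm)
  have hc0 : ∀ e, c e (h e) = 0 := fun e => by
    by_contra h0; exact hout e _ (hcA e _ h0)
  have hc0' : ∀ e, c' e (h e) = 0 := fun e => by
    by_contra h0; exact hout e _ (hcA' e _ h0)
  refine ⟨⟨A, p, h, fun e => c e + single (h e) 1 + c' e, ?_, ?_, ?_, ?_⟩⟩
  · intro e u v huv
    have : bdry (c e + single (h e) 1 + c' e) = single (p (tl e)) 1 + single (p (hd e)) 1 := by
      rw [map_add, map_add, hc, hc', bdry_of_ends (hk e), add_add_cancel_zmod2,
        add_add_cancel_zmod2]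
    rw [this]
    rw [hth e, Sym2.eq_iff] at huv
    rcases huv with ⟨h1, h2⟩ | ⟨h1, h2⟩ <;> rw [h1, h2]
    rw [add_comm]
  · intro e
    simp [hc0, hc0']
  · intro e v
    rw [hth e, Sym2.mem_iff]
    have h1 : a e ∈ A v ↔ v = tl e := by
      refine ⟨fun hv => ?_, fun hv => hv ▸ ha e⟩
      by_contra hvt; exact Set.disjoint_left.1 (hAA _ _ hvt) hv (ha e)
    have h2 : b e ∈ A v ↔ v = hd e := by
      refine ⟨fun hv => ?_, fun hv => hv ▸ hb e⟩
      by_contra hvt; exact Set.disjoint_left.1 (hAA _ _ hvt) hv (hb e)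
    have h3 : cut (A v) (h e) ≠ 0 ↔ ¬ (a e ∈ A v ↔ b e ∈ A v) := by
      rw [cut_ne_zero_iff]
      rcases hk e with ⟨h3, h4⟩ | ⟨h3, h4⟩ <;> rw [h3, h4]
      exact not_congr Iff.comm
    rw [h3, h1, h2]
    have := hne e
    grind
  · intro e k hD
    by_cases hkh : k = h e
    · exact Or.inl hkh
    right
    intro v
    by_cases h1 : c e k = 0
    · have h2 : c' e k ≠ 0 := fun h2 => hD (by
        simp [h1, h2, Finsupp.single_eq_of_ne hkh])
      exact cut_of_inside (hAA' _ _) (hcA' e k h2).1 (hcA' e k h2).2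
    · exact cut_of_inside (hAA' _ _) (hcA e k h1).1 (hcA e k h1).2

/-! ### From compact sets in the plane to regions in the grid -/

/-- The points of the grid with mesh `1 / M` that are close to `K`. -/
def net (M : ℝ) (K : Set (ℝ × ℝ)) : Set (ℤ × ℤ) :=
  {g | ∃ p ∈ K, |M * p.1 - g.1| ≤ 1 ∧ |M * p.2 - g.2| ≤ 1}

lemma reach_of_fst {N : Set (ℤ × ℤ)} {i i' j : ℤ} (h : |i - i'| ≤ 1) (h1 : (i, j) ∈ N)
    (h2 : (i', j) ∈ N) : Reach N (i, j) (i', j) := by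
  rcases lt_trichotomy i i' with hlt | rfl | hlt
  · obtain rfl : i' = i + 1 := by rw [abs_le] at h; omega
    exact .single ⟨⟨((i, j), false), by simp [tgt]⟩, h1, h2⟩
  · exact .refl
  · obtain rfl : i = i' + 1 := by rw [abs_le] at h; omega
    exact .single ⟨⟨((i', j), false), by simp [tgt]⟩, h1, h2⟩

lemma reach_of_snd {N : Set (ℤ × ℤ)} {i j j' : ℤ} (h : |j - j'| ≤ 1) (h1 : (i, j) ∈ N)
    (h2 : (i, j') ∈ N) : Reach N (i, j) (i, j') := by
  rcases lt_trichotomy j j' with hlt | rfl | hlt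
  · obtain rfl : j' = j + 1 := by rw [abs_le] at h; omega
    exact .single ⟨⟨((i, j), true), by simp [tgt]⟩, h1, h2⟩
  · exact .refl
  · obtain rfl : j = j' + 1 := by rw [abs_le] at h; omega
    exact .single ⟨⟨((i, j'), true), by simp [tgt]⟩, h1, h2⟩

/-- The corner `(i, j')` inherits its closeness to `p` from the two given points, one coordinate
from each. -/
lemma reach_local {M : ℝ} {K : Set (ℝ × ℝ)} {p : ℝ × ℝ} (hp : p ∈ K) {g g' : ℤ × ℤ}
    (h1 : |M * p.1 - g.1| ≤ 1) (h2 : |M * p.2 - g.2| ≤ 1) (h1' : |M * p.1 - g'.1| ≤ 1)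
    (h2' : |M * p.2 - g'.2| ≤ 1) (hd1 : |g.1 - g'.1| ≤ 1) (hd2 : |g.2 - g'.2| ≤ 1) :
    Reach (net M K) g g' := by
  obtain ⟨i, j⟩ := g
  obtain ⟨i', j'⟩ := g'
  exact (reach_of_snd (N := net M K) hd2 ⟨p, hp, h1, h2⟩ ⟨p, hp, h1, h2'⟩).trans
    (reach_of_fst (N := net M K) hd1 ⟨p, hp, h1, h2'⟩ ⟨p, hp, h1', h2'⟩)

/-- The errors in the applications add up to at most 3/2; integrality improves this to one grid
step. -/
lemma abs_sub_le_one_of_lt {a b : ℤ} (h : |(a : ℝ) - b| < 2) : |a - b| ≤ 1 := by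
  have : |a - b| < 2 := by exact_mod_cast h
  omega

/-- The grid point closest to `M p`. -/
noncomputable def nearest (M : ℝ) (p : ℝ × ℝ) : ℤ × ℤ := (round (M * p.1), round (M * p.2))

lemma reach_nearest_of_near {M : ℝ} {K : Set (ℝ × ℝ)} {p q : ℝ × ℝ} (hp : p ∈ K)
    (h1 : |M * p.1 - M * q.1| ≤ 1 / 2) (h2 : |M * p.2 - M * q.2| ≤ 1 / 2) :
    Reach (net M K) (nearest M p) (nearest M q) := by
  have a1 := abs_sub_round (M * p.1)
  have a2 := abs_sub_round (M * p.2)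
  have b1 := abs_sub_round (M * q.1)
  have b2 := abs_sub_round (M * q.2)
  rw [abs_le] at h1 h2 a1 a2 b1 b2
  refine reach_local hp ?_ ?_ ?_ ?_ (abs_sub_le_one_of_lt ?_) (abs_sub_le_one_of_lt ?_) <;>
    simp only [nearest, abs_le, abs_lt] <;> constructor <;> linarith

lemma reach_nearest {M : ℝ} {K : Set (ℝ × ℝ)} (hK : IsPreconnected K)
    {p q : ℝ × ℝ} (hp : p ∈ K) (hq : q ∈ K) : Reach (net M K) (nearest M p) (nearest M q) := by
  refine hK.induction₂' (fun p q => Reach (net M K) (nearest M p) (nearest M q)) ?_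
    (fun x y z _ _ _ h1 h2 => h1.trans h2) hp hq
  intro x hx
  have c1 : ∀ᶠ y : ℝ × ℝ in nhds x, |M * x.1 - M * y.1| < 1 / 2 :=
    ContinuousAt.eventually_lt (by fun_prop) continuousAt_const (by simp)
  have c2 : ∀ᶠ y : ℝ × ℝ in nhds x, |M * x.2 - M * y.2| < 1 / 2 :=
    ContinuousAt.eventually_lt (by fun_prop) continuousAt_const (by simp)
  filter_upwards [nhdsWithin_le_nhds c1, nhdsWithin_le_nhds c2, self_mem_nhdsWithin]
    with y h1 h2 hy
  exact ⟨reach_nearest_of_near hx h1.le h2.le, reach_nearest_of_near hy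
    (by rw [abs_sub_comm]; exact h1.le) (by rw [abs_sub_comm]; exact h2.le)⟩

lemma reach_net {M : ℝ} {K : Set (ℝ × ℝ)} (hK : IsPreconnected K) {g g' : ℤ × ℤ}
    (hg : g ∈ net M K) (hg' : g' ∈ net M K) : Reach (net M K) g g' := by
  obtain ⟨p, hp, h1, h2⟩ := hg
  obtain ⟨q, hq, h3, h4⟩ := hg'
  have a1 := abs_sub_round (M * p.1)
  have a2 := abs_sub_round (M * p.2)
  have b1 := abs_sub_round (M * q.1)
  have b2 := abs_sub_round (M * q.2)
  have hpp : Reach (net M K) g (nearest M p) := by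
    rw [abs_le] at h1 h2 a1 a2
    refine reach_local hp ?_ ?_ ?_ ?_ (abs_sub_le_one_of_lt ?_) (abs_sub_le_one_of_lt ?_) <;>
      simp only [nearest, abs_le, abs_lt] <;> constructor <;> linarith
  have hqq : Reach (net M K) (nearest M q) g' := by
    rw [abs_le] at h3 h4 b1 b2
    refine reach_local hq ?_ ?_ ?_ ?_ (abs_sub_le_one_of_lt ?_) (abs_sub_le_one_of_lt ?_) <;>
      simp only [nearest, abs_le, abs_lt] <;> constructor <;> linarith
  exact (hpp.trans (reach_nearest hK hp hq)).trans hqq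

open Filter in
-- A common grid point would put points of `K` and `L` within `2 / M` of each other, against their
-- positive distance.
lemma eventually_disjoint_net {K L : Set (ℝ × ℝ)} (hK : IsCompact K) (hL : IsCompact L)
    (hd : Disjoint K L) : ∀ᶠ M : ℝ in atTop, Disjoint (net M K) (net M L) := by
  obtain ⟨δ, hδ, hdis⟩ := hd.exists_thickenings hK hL.isClosed
  filter_upwards [eventually_gt_atTop (2 / δ), eventually_gt_atTop 0] with M hM hM0
  rw [Set.disjoint_left]
  rintro g ⟨p, hp, h1, h2⟩ ⟨q, hq, h3, h4⟩
  have hMδ : 2 < M * δ := by rwa [div_lt_iff₀ hδ] at hM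
  have hdist : dist p q < δ := by
    rw [Prod.dist_eq, max_lt_iff, Real.dist_eq, Real.dist_eq]
    rw [abs_le] at h1 h2 h3 h4
    constructor <;> rw [abs_lt] <;> constructor <;> nlinarith
  exact Set.disjoint_left.1 hdis (Metric.mem_thickening_iff.2 ⟨p, hp, by rwa [dist_comm] at hdist⟩)
    (Metric.self_subset_thickening hδ L hq)

open Filter in
/-- Compact connected regions for the vertices and the edges of `G` in the plane give a drawing
of `G` in the grid. -/
theorem exists_model_of_compact {V : Type*} [Finite V] {G : SimpleGraph V} (K : V → Set (ℝ × ℝ))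
    (L : G.edgeSet → Set (ℝ × ℝ)) (hne : ∀ v, (K v).Nonempty)
    (hK : ∀ v, IsCompact (K v)) (hL : ∀ e, IsCompact (L e))
    (hK' : ∀ v, IsPreconnected (K v)) (hL' : ∀ e, IsPreconnected (L e))
    (hKK : ∀ u v, u ≠ v → Disjoint (K u) (K v)) (hLL : ∀ e f, e ≠ f → Disjoint (L e) (L f))
    (hKL : ∀ (e : G.edgeSet) v, v ∉ (e : Sym2 V) → Disjoint (K v) (L e))
    (hmeet : ∀ (e : G.edgeSet) v, v ∈ (e : Sym2 V) → (K v ∩ L e).Nonempty) :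
    Nonempty (Model G) := by
  have e1 : ∀ᶠ M : ℝ in atTop, ∀ u v, u ≠ v → Disjoint (net M (K u)) (net M (K v)) := by
    simp only [eventually_all]
    exact fun u v h => eventually_disjoint_net (hK u) (hK v) (hKK u v h)
  have e2 : ∀ᶠ M : ℝ in atTop, ∀ e f, e ≠ f → Disjoint (net M (L e)) (net M (L f)) := by
    simp only [eventually_all]
    exact fun u v h => eventually_disjoint_net (hL u) (hL v) (hLL u v h)
  have e3 : ∀ᶠ M : ℝ in atTop, ∀ (e : G.edgeSet) v, v ∉ (e : Sym2 V) →
      Disjoint (net M (K v)) (net M (L e)) := by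
    simp only [eventually_all]
    exact fun u v h => eventually_disjoint_net (hK v) (hL u) (hKL u v h)
  obtain ⟨M, h1, h2, h3⟩ := (e1.and (e2.and e3)).exists
  have hmem : ∀ (S : Set (ℝ × ℝ)) p, p ∈ S → nearest M p ∈ net M S := fun S p hp =>
    ⟨p, hp, (abs_sub_round _).trans (by norm_num), (abs_sub_round _).trans (by norm_num)⟩
  refine exists_model_of_regions (fun v => net M (K v)) (fun e => net M (L e))
    (fun v => (hne v).imp' (nearest M) (hmem _)) (fun v g hg g' hg' => reach_net (hK' v) hg hg')
    (fun e g hg g' hg' => reach_net (hL' e) hg hg') h1 h2 h3 ?_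
  intro e v hv
  obtain ⟨p, hp, hp'⟩ := hmeet e v hv
  exact ⟨nearest M p, hmem _ _ hp, hmem _ _ hp'⟩

end GridPlane

/-! ### Planar embeddings: arcs cut into thirds -/

namespace SimpleGraph.PlanarEmbedding

variable {V : Type*} {G : SimpleGraph V} (E : G.PlanarEmbedding)

open Set unitInterval

lemma eq_zero_of_arc_eq_pos_fst {d : G.Dart} {t : unitInterval} (h : E.arc d t = E.pos d.fst) :
    t = 0 := E.arc_injective d (h.trans (E.arc d).source.symm)

lemma eq_one_of_arc_eq_pos_snd {d : G.Dart} {t : unitInterval} (h : E.arc d t = E.pos d.snd) :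
    t = 1 := E.arc_injective d (h.trans (E.arc d).target.symm)

lemma eq_zero_or_eq_one_of_arc_eq_pos {d : G.Dart} {t : unitInterval} {v : V}
    (h : E.arc d t = E.pos v) : (t = 0 ∧ v = d.fst) ∨ (t = 1 ∧ v = d.snd) := by
  rcases E.arc_vertex d t v h with rfl | rfl
  · exact Or.inl ⟨E.eq_zero_of_arc_eq_pos_fst h, rfl⟩
  · exact Or.inr ⟨E.eq_one_of_arc_eq_pos_snd h, rfl⟩

lemma arc_symm_apply (d : G.Dart) (t : unitInterval) : E.arc d.symm t = E.arc d (σ t) :=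
  DFunLike.congr_fun (E.arc_symm d) t

/-- Arcs of distinct edges meet only in vertices, and an arc passes through a vertex only at
parameter 0 or 1. -/
lemma eq_or_of_arc_eq {d d' : G.Dart} {s t : unitInterval} (h : E.arc d s = E.arc d' t) :
    (d = d' ∧ s = t) ∨ (d = d'.symm ∧ s = σ t) ∨
      (d.edge ≠ d'.edge ∧ (s = 0 ∨ s = 1) ∧ (t = 0 ∨ t = 1) ∧
        (if s = 0 then d.fst else d.snd) = (if t = 0 then d'.fst else d'.snd)) := by
  by_cases he : d.edge = d'.edge
  · rcases (SimpleGraph.dart_edge_eq_iff d d').1 he with rfl | rfl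
    · exact Or.inl ⟨rfl, E.arc_injective d h⟩
    · refine Or.inr (Or.inl ⟨rfl, ?_⟩)
      rw [E.arc_symm_apply] at h
      have := E.arc_injective d' h
      rw [← this, unitInterval.symm_symm]
  · obtain ⟨v, hv⟩ := E.arc_inter d d' he s t h
    refine Or.inr (Or.inr ⟨he, ?_⟩)
    rcases E.eq_zero_or_eq_one_of_arc_eq_pos hv with ⟨rfl, h1⟩ | ⟨rfl, h1⟩ <;>
      rcases E.eq_zero_or_eq_one_of_arc_eq_pos (h.symm.trans hv) with ⟨rfl, h2⟩ | ⟨rfl, h2⟩ <;>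
      simp [← h1, ← h2]

/-- The part of the drawing that belongs to `v`: the first third of every arc at `v`. -/
def star (v : V) : Set (EuclideanSpace ℝ (Fin 2)) :=
  {E.pos v} ∪ ⋃ d : {d : G.Dart // d.fst = v}, E.arc d '' {t | (t : ℝ) ≤ 1 / 3}

/-- The middle third of an arc. -/
def middle (d : G.Dart) : Set (EuclideanSpace ℝ (Fin 2)) :=
  E.arc d '' {t | (1 / 3 : ℝ) ≤ t ∧ (t : ℝ) ≤ 2 / 3}

lemma mem_star {v : V} {p : EuclideanSpace ℝ (Fin 2)} :
    p ∈ E.star v ↔ p = E.pos v ∨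
      ∃ d : G.Dart, d.fst = v ∧ ∃ t : unitInterval, (t : ℝ) ≤ 1 / 3 ∧ E.arc d t = p := by
  simp only [star, mem_union, mem_singleton_iff, mem_iUnion]
  exact or_congr_right ⟨fun ⟨⟨d, hd⟩, t, ht, h⟩ => ⟨d, hd, t, ht, h⟩,
    fun ⟨d, hd, t, ht, h⟩ => ⟨⟨d, hd⟩, t, ht, h⟩⟩

lemma isCompact_star [Finite V] (v : V) : IsCompact (E.star v) := by
  have : Finite G.Dart := Finite.of_injective _ SimpleGraph.Dart.toProd_injective
  refine isCompact_singleton.union (isCompact_iUnion fun d => ?_)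
  exact (isClosed_le continuous_subtype_val continuous_const).isCompact.image (E.arc d).continuous

/-- All the first thirds contain `E.pos v`; the extra singleton in `star` serves an isolated vertex.
-/
lemma isPreconnected_star (v : V) : IsPreconnected (E.star v) := by
  have h : E.star v = {E.pos v} ∪
      ⋃ d : {d : G.Dart // d.fst = v}, ({E.pos v} ∪ E.arc d '' {t | (t : ℝ) ≤ 1 / 3}) := by
    ext p
    simp only [star, mem_union, mem_singleton_iff, mem_iUnion]
    exact ⟨fun h => h.imp_right fun ⟨d, hd⟩ => ⟨d, Or.inr hd⟩,
      fun h => h.elim Or.inl fun ⟨d, hd⟩ => hd.imp_right fun hd => ⟨d, hd⟩⟩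
  have hp : ∀ d : {d : G.Dart // d.fst = v}, E.pos v ∈ E.arc d '' {t | (t : ℝ) ≤ 1 / 3} := by
    rintro ⟨d, rfl⟩
    exact ⟨0, by simp, (E.arc d).source⟩
  rcases isEmpty_or_nonempty {d : G.Dart // d.fst = v} with hE | hE
  · rw [h, iUnion_of_empty, union_empty]
    exact isPreconnected_singleton
  · refine (isPreconnected_singleton).union (E.pos v) rfl ?_ ?_
    · exact mem_iUnion.2 ⟨Classical.arbitrary _, hp _⟩
    · refine isPreconnected_iUnion ⟨E.pos v, mem_iInter.2 hp⟩ fun d => ?_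
      refine IsPreconnected.image ?_ _ (E.arc d).continuous.continuousOn
      refine Set.OrdConnected.isPreconnected ⟨fun x _ y hy z hz => ?_⟩
      exact le_trans (Subtype.coe_le_coe.2 hz.2) hy

lemma isCompact_middle (d : G.Dart) : IsCompact (E.middle d) := by
  refine IsCompact.image (IsClosed.isCompact ?_) (E.arc d).continuous
  exact (isClosed_le continuous_const continuous_subtype_val).inter
    (isClosed_le continuous_subtype_val continuous_const)

lemma isPreconnected_middle (d : G.Dart) : IsPreconnected (E.middle d) := by
  refine IsPreconnected.image ?_ _ (E.arc d).continuous.continuousOn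
  refine Set.OrdConnected.isPreconnected ⟨fun x hx y hy z hz => ?_⟩
  exact ⟨hx.1.trans (Subtype.coe_le_coe.2 hz.1), le_trans (Subtype.coe_le_coe.2 hz.2) hy.2⟩

lemma ne_one_of_le {t : unitInterval} (h : (t : ℝ) ≤ 2 / 3) : t ≠ 1 := by
  rintro rfl; norm_num at h

lemma ne_zero_of_le {t : unitInterval} (h : (1 / 3 : ℝ) ≤ t) : t ≠ 0 := by
  rintro rfl; norm_num at h

lemma disjoint_star {u v : V} (huv : u ≠ v) : Disjoint (E.star u) (E.star v) := by
  rw [Set.disjoint_left]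
  intro p hp hq
  rcases E.mem_star.1 hp with rfl | ⟨d, rfl, s, hs, rfl⟩
  · rcases E.mem_star.1 hq with h | ⟨d', rfl, t, ht, h⟩
    · exact huv (E.pos_injective h)
    · rcases E.eq_zero_or_eq_one_of_arc_eq_pos h with ⟨_, h1⟩ | ⟨h1, _⟩
      · exact huv h1
      · exact ne_one_of_le (ht.trans (by norm_num)) h1
  · have hs1 := ne_one_of_le (hs.trans (by norm_num))
    rcases E.mem_star.1 hq with h | ⟨d', rfl, t, ht, h⟩
    · rcases E.eq_zero_or_eq_one_of_arc_eq_pos h with ⟨_, h1⟩ | ⟨h1, _⟩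
      · exact huv h1.symm
      · exact hs1 h1
    · have ht1 := ne_one_of_le (ht.trans (by norm_num))
      rcases E.eq_or_of_arc_eq h with ⟨rfl, _⟩ | ⟨_, h2⟩ | ⟨_, h2, h3, h4⟩
      · exact huv rfl
      · rw [h2, unitInterval.coe_symm_eq] at ht
        linarith
      · rw [if_pos (h2.resolve_right ht1), if_pos (h3.resolve_right hs1)] at h4
        exact huv h4.symm

lemma disjoint_middle {d d' : G.Dart} (h : d.edge ≠ d'.edge) :
    Disjoint (E.middle d) (E.middle d') := by
  rw [Set.disjoint_left]
  rintro _ ⟨s, hs, rfl⟩ ⟨t, ht, hst⟩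
  rcases E.eq_or_of_arc_eq hst with ⟨rfl, _⟩ | ⟨rfl, _⟩ | ⟨_, h2 | h2, _⟩
  · exact h rfl
  · exact h (d.edge_symm).symm
  · exact ne_zero_of_le ht.1 h2
  · exact ne_one_of_le ht.2 h2

lemma disjoint_star_middle {d : G.Dart} {v : V} (h : v ∉ d.edge) :
    Disjoint (E.star v) (E.middle d) := by
  rw [Set.disjoint_left]
  rintro _ hp ⟨s, hs, rfl⟩
  rcases E.mem_star.1 hp with h1 | ⟨d', rfl, t, ht, h1⟩
  · rcases E.eq_zero_or_eq_one_of_arc_eq_pos h1 with ⟨h2, _⟩ | ⟨h2, _⟩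
    · exact ne_zero_of_le hs.1 h2
    · exact ne_one_of_le hs.2 h2
  · have hd' : d'.fst ∈ d'.edge := by simp [SimpleGraph.Dart.edge]
    rcases E.eq_or_of_arc_eq h1.symm with ⟨rfl, _⟩ | ⟨rfl, _⟩ | ⟨_, h2 | h2, _⟩
    · exact h hd'
    · exact h (by rwa [SimpleGraph.Dart.edge_symm])
    · exact ne_zero_of_le hs.1 h2
    · exact ne_one_of_le hs.2 h2

lemma star_inter_middle {d : G.Dart} {v : V} (h : v ∈ d.edge) :
    (E.star v ∩ E.middle d).Nonempty := by
  have h3 : (1 / 3 : ℝ) ∈ I := ⟨by norm_num, by norm_num⟩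
  have key : ∀ d : G.Dart, E.arc d ⟨1 / 3, h3⟩ ∈ E.star d.fst := fun d =>
    E.mem_star.2 (Or.inr ⟨d, rfl, _, le_rfl, rfl⟩)
  have hd : v = d.fst ∨ v = d.snd := by simpa [SimpleGraph.Dart.edge] using h
  rcases hd with rfl | rfl
  · exact ⟨_, key d, ⟨_, ⟨le_rfl, by norm_num⟩, rfl⟩⟩
  · refine ⟨_, key d.symm, ⟨σ ⟨1 / 3, h3⟩, ⟨?_, ?_⟩, ?_⟩⟩
    · rw [unitInterval.coe_symm_eq]; norm_num
    · rw [unitInterval.coe_symm_eq]; norm_num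
    · rw [E.arc_symm_apply]

/-- A planar embedding gives a drawing in the grid. -/
theorem nonempty_model (E : G.PlanarEmbedding) [Finite V] : Nonempty (GridPlane.Model G) := by
  let f : EuclideanSpace ℝ (Fin 2) → ℝ × ℝ := fun p => (p 0, p 1)
  have hf : Continuous f := by fun_prop
  have hfi : Function.Injective f := by
    intro p q h
    rw [Prod.mk.injEq] at h
    ext i
    fin_cases i
    exacts [h.1, h.2]
  have hdart : ∀ e : G.edgeSet, ∃ d : G.Dart, d.edge = e := by
    rintro ⟨e, he⟩
    induction e with
    | h u v => exact ⟨⟨(u, v), he⟩, rfl⟩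
  choose D hD using hdart
  have hdis : ∀ {S T : Set (EuclideanSpace ℝ (Fin 2))}, Disjoint S T → Disjoint (f '' S) (f '' T) :=
    fun h => (Set.disjoint_image_iff hfi).2 h
  refine GridPlane.exists_model_of_compact (fun v => f '' E.star v) (fun e => f '' E.middle (D e))
    (fun v => ⟨_, mem_image_of_mem f (E.mem_star.2 (Or.inl rfl))⟩)
    (fun v => (E.isCompact_star v).image hf) (fun e => (E.isCompact_middle _).image hf)
    (fun v => (E.isPreconnected_star v).image _ hf.continuousOn)
    (fun e => (E.isPreconnected_middle _).image _ hf.continuousOn)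
    (fun u v h => hdis (E.disjoint_star h))
    (fun e e' h => hdis (E.disjoint_middle ?_)) (fun e v h => hdis (E.disjoint_star_middle ?_))
    (fun e v h => ?_)
  · rw [hD, hD]; exact fun h' => h (Subtype.ext h')
  · rwa [hD]
  · obtain ⟨p, h1, h2⟩ := E.star_inter_middle (d := D e) (v := v) (by rwa [hD])
    exact ⟨f p, mem_image_of_mem f h1, mem_image_of_mem f h2⟩

/-- The restriction of a planar embedding to an induced subgraph. -/
def induce (W : Set V) : (G.induce W).PlanarEmbedding where
  pos v := E.pos v
  pos_injective := E.pos_injective.comp Subtype.val_injective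
  arc d := E.arc ((Embedding.induce W).toHom.mapDart d)
  arc_symm d := E.arc_symm ((Embedding.induce W).toHom.mapDart d)
  arc_injective d := E.arc_injective _
  arc_vertex d t v h := by
    rcases E.arc_vertex _ t v h with h | h
    · exact Or.inl (Subtype.ext h)
    · exact Or.inr (Subtype.ext h)
  arc_inter d d' h s t hst := by
    have hne : ((Embedding.induce W).toHom.mapDart d : G.Dart).edge ≠
        ((Embedding.induce W).toHom.mapDart d').edge := by
      intro h'
      refine h (Sym2.map.injective Subtype.val_injective ?_)
      exact h'
    rcases E.eq_or_of_arc_eq hst with ⟨h1, _⟩ | ⟨h1, _⟩ | ⟨_, h2 | h2, _⟩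
    · exact absurd (congrArg Dart.edge h1) hne
    · exact absurd ((congrArg Dart.edge h1).trans (Dart.edge_symm _)) hne
    · exact ⟨d.fst, by rw [h2]; exact (E.arc _).source⟩
    · exact ⟨d.snd, by rw [h2]; exact (E.arc _).target⟩

end SimpleGraph.PlanarEmbedding

namespace SimpleGraph

lemma IsPlanar.induce {V : Type*} {G : SimpleGraph V} (hG : G.IsPlanar) (W : Set V) :
    (G.induce W).IsPlanar := hG.map fun E => E.induce W

/-- A planar graph with at least `2n - 3` edges and at least three vertices has a triangle. -/
theorem IsPlanar.exists_triangle {V : Type*} [Finite V] {G : SimpleGraph V} (hG : G.IsPlanar)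
    (h3 : 3 ≤ Nat.card V) (he : 2 * Nat.card V ≤ G.edgeSet.ncard + 3) :
    ∃ a b c, G.Adj a b ∧ G.Adj b c ∧ G.Adj c a := by
  classical
  have := Fintype.ofFinite V
  obtain ⟨E⟩ := hG
  obtain ⟨m⟩ := E.nonempty_model
  obtain ⟨Φ, l, r, hd⟩ := m.exists_dual
  by_contra! hc
  rw [← Nat.card_coe_set_eq, Nat.card_eq_fintype_card, Nat.card_eq_fintype_card] at he
  rw [Nat.card_eq_fintype_card] at h3
  have : Nonempty V := Fintype.card_pos_iff.1 (by omega)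
  have := GridPlane.card_edgeSet_le_of_dual hc l r hd (by omega)
  omega

end SimpleGraph

/-! ### Tight vertex sets and blockers -/

namespace SimpleGraph

variable {V : Type*} {G : SimpleGraph V}

/-- The edges of `G` with both ends in `W`. -/
def edgesIn (G : SimpleGraph V) (W : Set V) : Set (Sym2 V) :=
  {e | e ∈ G.edgeSet ∧ ∀ v ∈ e, v ∈ W}

/-- The freedom number of the subgraph induced by `W`. -/
noncomputable def freedomOn (G : SimpleGraph V) (W : Set V) : ℤ :=
  2 * (W.ncard : ℤ) - ((G.edgesIn W).ncard : ℤ) - 3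

/-- A vertex set that induces a subgraph with at least two vertices and no freedom. -/
def IsTight (G : SimpleGraph V) (W : Set V) : Prop :=
  2 ≤ W.ncard ∧ G.freedomOn W = 0

lemma mem_edgesIn {W : Set V} {u v : V} :
    s(u, v) ∈ G.edgesIn W ↔ G.Adj u v ∧ u ∈ W ∧ v ∈ W := by
  simp [edgesIn]

lemma edgesIn_mono {A B : Set V} (h : A ⊆ B) : G.edgesIn A ⊆ G.edgesIn B :=
  fun _ he => ⟨he.1, fun v hv => h (he.2 v hv)⟩

lemma edgesIn_univ : G.edgesIn Set.univ = G.edgeSet := by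
  ext e; simp [edgesIn]

lemma freedomOn_univ : G.freedomOn Set.univ = G.freedom := by
  rw [freedomOn, freedom, edgesIn_univ, Set.ncard_univ]

lemma edgesIn_eq_induce (W : Set V) : G.edgesIn W = ((⊤ : G.Subgraph).induce W).edgeSet := by
  ext e
  induction e with
  | h u v =>
    rw [mem_edgesIn]
    simp only [Subgraph.mem_edgeSet, Subgraph.induce_adj, Subgraph.top_adj]
    tauto

lemma ncard_coe_edgeSet (H : G.Subgraph) : H.coe.edgeSet.ncard = H.edgeSet.ncard := by
  rw [← H.image_coe_edgeSet_coe,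
    Set.ncard_image_of_injective _ (Sym2.map.injective Subtype.val_injective)]

lemma freedom_coe (H : G.Subgraph) :
    H.coe.freedom = 2 * (H.verts.ncard : ℤ) - (H.edgeSet.ncard : ℤ) - 3 := by
  rw [freedom, ncard_coe_edgeSet, Nat.card_coe_set_eq]

lemma freedom_induce (W : Set V) : ((⊤ : G.Subgraph).induce W).coe.freedom = G.freedomOn W := by
  rw [freedom_coe, freedomOn, edgesIn_eq_induce]; rfl

lemma ncard_edgesIn_image {W : Type*} [Finite V] {H : SimpleGraph W} {f : W → V}
    (hf : Function.Injective f)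
    (hadj : ∀ a b, H.Adj a b → G.Adj (f a) (f b)) (X : Set W) :
    (H.edgesIn X).ncard ≤ (G.edgesIn (f '' X)).ncard := by
  rw [← Set.ncard_image_of_injective _ (Sym2.map.injective hf)]
  refine Set.ncard_le_ncard ?_ (Set.toFinite _)
  rintro _ ⟨e, he, rfl⟩
  induction e with
  | h a b =>
    rw [mem_edgesIn] at he
    rw [Sym2.map_mk, mem_edgesIn]
    exact ⟨hadj _ _ he.1, Set.mem_image_of_mem f he.2.1, Set.mem_image_of_mem f he.2.2⟩

lemma ne_of_mem_edgesIn {A B : Set V} {y : V} (h : A ∩ B = {y}) {e f : Sym2 V}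
    (he : e ∈ G.edgesIn A) (hf : f ∈ G.edgesIn B) : e ≠ f := by
  rintro rfl
  induction e with
  | h u v =>
    rw [mem_edgesIn] at he hf
    have h1 : u ∈ A ∩ B := ⟨he.2.1, hf.2.1⟩
    have h2 : v ∈ A ∩ B := ⟨he.2.2, hf.2.2⟩
    rw [h] at h1 h2
    exact he.1.ne (h1.trans h2.symm)

section Independent

variable [Finite V]

/-- On a given vertex set the induced subgraph has the most edges, hence the least freedom. -/
lemma isIndependent_iff : G.IsIndependent ↔ ∀ W : Set V, 2 ≤ W.ncard → 0 ≤ G.freedomOn W := by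
  constructor
  · intro h W hW
    rw [← freedom_induce]
    exact h _ hW
  · intro h H hH
    refine (h H.verts hH).trans ?_
    rw [freedom_coe, freedomOn]
    have : H.edgeSet.ncard ≤ (G.edgesIn H.verts).ncard := by
      refine Set.ncard_le_ncard (fun e he => ⟨H.edgeSet_subset he, fun v hv => ?_⟩) (Set.toFinite _)
      exact H.mem_verts_of_mem_edge he hv
    omega

lemma IsIndependent.of_injective {W : Type*} {H : SimpleGraph W} (hG : G.IsIndependent) {f : W → V}
    (hf : Function.Injective f) (hadj : ∀ a b, H.Adj a b → G.Adj (f a) (f b)) :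
    H.IsIndependent := by
  have := Finite.of_injective f hf
  rw [isIndependent_iff] at hG ⊢
  intro X hX
  have h1 := hG (f '' X) (by rwa [Set.ncard_image_of_injective _ hf])
  have h2 := ncard_edgesIn_image hf hadj X
  rw [freedomOn, Set.ncard_image_of_injective _ hf] at h1
  rw [freedomOn]
  omega

lemma IsTight.isMaximallyIndependent (hG : G.IsIndependent) {W : Set V} (hW : G.IsTight W) :
    ((⊤ : G.Subgraph).induce W).coe.IsMaximallyIndependent :=
  ⟨hG.of_injective Subtype.val_injective fun _ _ h =>
    ((⊤ : G.Subgraph).induce W).adj_sub h, by rw [freedom_induce, hW.2]⟩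

lemma isTight_pair (hG : G.IsIndependent) {x y : V} (h : G.Adj x y) : G.IsTight {x, y} := by
  have h2 : ({x, y} : Set V).ncard = 2 := Set.ncard_pair h.ne
  refine ⟨h2.ge, le_antisymm ?_ (isIndependent_iff.1 hG _ h2.ge)⟩
  have : 0 < (G.edgesIn {x, y}).ncard :=
    (Set.ncard_pos (Set.toFinite _)).2 ⟨s(x, y), mem_edgesIn.2 ⟨h, by simp, by simp⟩⟩
  rw [freedomOn, h2]
  push_cast
  omega

/-- Two tight sets with at least two common vertices have a tight union, and no edge joins their
differences. -/
lemma IsTight.union (hG : G.IsIndependent) {A B : Set V} (hA : G.IsTight A) (hB : G.IsTight B)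
    (h2 : 2 ≤ (A ∩ B).ncard) :
    G.IsTight (A ∪ B) ∧ G.IsTight (A ∩ B) ∧
      ∀ u ∈ A, ∀ v ∈ B, G.Adj u v → u ∈ B ∨ v ∈ A := by
  have hsub : G.edgesIn A ∪ G.edgesIn B ⊆ G.edgesIn (A ∪ B) :=
    Set.union_subset (edgesIn_mono Set.subset_union_left) (edgesIn_mono Set.subset_union_right)
  have hint : G.edgesIn A ∩ G.edgesIn B = G.edgesIn (A ∩ B) := by
    ext e
    exact ⟨fun h => ⟨h.1.1, fun v hv => ⟨h.1.2 v hv, h.2.2 v hv⟩⟩,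
      fun h => ⟨⟨h.1, fun v hv => (h.2 v hv).1⟩, ⟨h.1, fun v hv => (h.2 v hv).2⟩⟩⟩
  have c1 := Set.ncard_union_add_ncard_inter A B (Set.toFinite _) (Set.toFinite _)
  have c2 := Set.ncard_union_add_ncard_inter (G.edgesIn A) (G.edgesIn B)
    (Set.toFinite _) (Set.toFinite _)
  rw [hint] at c2
  have c3 : (G.edgesIn A ∪ G.edgesIn B).ncard ≤ (G.edgesIn (A ∪ B)).ncard :=
    Set.ncard_le_ncard hsub (Set.toFinite _)
  have h2' : 2 ≤ (A ∪ B).ncard :=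
    hA.1.trans (Set.ncard_le_ncard Set.subset_union_left (Set.toFinite _))
  have f1 := isIndependent_iff.1 hG _ h2
  have f2 := isIndependent_iff.1 hG _ h2'
  have f3 := hA.2
  have f4 := hB.2
  rw [freedomOn] at f1 f2 f3 f4
  -- By inclusion and exclusion, the freedoms of `A ∪ B` and `A ∩ B` and the number of edges in `A ∪
  -- B` that lie in neither set add up to zero. All three are nonnegative, so all vanish.
  have heq : G.edgesIn A ∪ G.edgesIn B = G.edgesIn (A ∪ B) :=
    Set.eq_of_subset_of_ncard_le hsub (by omega) (Set.toFinite _)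
  rw [heq] at c2
  refine ⟨⟨h2', by rw [freedomOn]; omega⟩, ⟨h2, by rw [freedomOn]; omega⟩, ?_⟩
  intro u hu v hv huv
  have : s(u, v) ∈ G.edgesIn (A ∪ B) := mem_edgesIn.2 ⟨huv, Or.inl hu, Or.inr hv⟩
  rw [← heq] at this
  rcases this with h | h <;> rw [mem_edgesIn] at h
  · exact Or.inr h.2.2
  · exact Or.inl h.2.1

lemma two_le_ncard {W : Set V} {a b : V} (ha : a ∈ W) (hb : b ∈ W) (h : a ≠ b) : 2 ≤ W.ncard := by
  rw [← Set.ncard_pair h]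
  exact Set.ncard_le_ncard (Set.insert_subset ha (Set.singleton_subset_iff.2 hb)) (Set.toFinite _)

/-- A tight set that contains the edge `xy` of a triangle `xyz`, but not `z`. -/
def IsBlocker (G : SimpleGraph V) (x y z : V) (W : Set V) : Prop :=
  G.IsTight W ∧ x ∈ W ∧ y ∈ W ∧ z ∉ W

/-- With a second common vertex, `IsTight.union` would forbid the edge `zx`, which runs from `A \ B`
to `B \ A`. -/
lemma IsBlocker.inter (hG : G.IsIndependent) {x y z : V} (hzx : G.Adj z x) {A B : Set V}
    (hA : G.IsBlocker x y z A) (hB : G.IsBlocker y z x B) : A ∩ B = {y} := by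
  refine Set.eq_singleton_iff_unique_mem.2 ⟨⟨hA.2.2.1, hB.2.1⟩, fun w hw => ?_⟩
  by_contra hwy
  have := (hA.1.union hG hB.1 (two_le_ncard hw ⟨hA.2.2.1, hB.2.1⟩ hwy)).2.2 x hA.2.1 z hB.2.2.1
    hzx.symm
  exact this.elim hB.2.2.2 hA.2.2.2

lemma exists_maximal_blocker (hG : G.IsIndependent) {x y z : V} (hxy : G.Adj x y)
    (hyz : G.Adj y z) (hzx : G.Adj z x) : ∃ W, Maximal (G.IsBlocker x y z) W := by
  refine (Set.toFinite {W | G.IsBlocker x y z W}).exists_maximal ⟨{x, y}, isTight_pair hG hxy, ?_⟩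
  simp [hzx.ne, hyz.ne.symm]

end Independent

/-! ### Counting vertices and edges under a contraction -/

section Contract

/-- The vertices of `G` that become vertices in `W` after a contraction. -/
def liftSet (e : Sym2 V) (W : Set (Quotient (contractSetoid e))) : Set V :=
  Quotient.mk (contractSetoid e) ⁻¹' W

lemma mk_eq_mk {x y u v : V} :
    Quotient.mk (contractSetoid s(x, y)) u = Quotient.mk (contractSetoid s(x, y)) v ↔
      u = v ∨ ((u = x ∨ u = y) ∧ (v = x ∨ v = y)) := by
  rw [Quotient.eq]
  change (u = v ∨ (u ∈ s(x, y) ∧ v ∈ s(x, y))) ↔ _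
  simp

lemma mem_liftSet_comm {x y : V} {W : Set (Quotient (contractSetoid s(x, y)))} :
    y ∈ liftSet s(x, y) W ↔ x ∈ liftSet s(x, y) W := by
  have : Quotient.mk (contractSetoid s(x, y)) y = Quotient.mk (contractSetoid s(x, y)) x :=
    mk_eq_mk.2 (by simp)
  change Quotient.mk _ y ∈ W ↔ Quotient.mk _ x ∈ W
  rw [this]

/-- Without `y`, every class has exactly one representative; `x` stands for the merged vertex. -/
lemma ncard_liftSet_diff {x y : V} (hxy : x ≠ y) (W : Set (Quotient (contractSetoid s(x, y)))) :
    (liftSet s(x, y) W \ {y}).ncard = W.ncard := by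
  have himg : Quotient.mk (contractSetoid s(x, y)) '' (liftSet s(x, y) W \ {y}) = W := by
    ext q
    constructor
    · rintro ⟨u, hu, rfl⟩
      exact hu.1
    · intro hq
      induction q using Quotient.inductionOn with
      | h u =>
        by_cases huy : u = y
        · subst huy
          exact ⟨x, ⟨mem_liftSet_comm.1 hq, hxy⟩, mk_eq_mk.2 (by simp)⟩
        · exact ⟨u, ⟨hq, huy⟩, rfl⟩
  conv_rhs => rw [← himg]
  refine (Set.InjOn.ncard_image fun u hu v hv huv => ?_).symm
  rw [mk_eq_mk] at huv
  have h1 : u ≠ y := hu.2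
  have h2 : v ≠ y := hv.2
  grind

lemma edgesIn_contract {x y : V} (W : Set (Quotient (contractSetoid s(x, y)))) :
    (G.contract s(x, y)).edgesIn W =
      Sym2.map (Quotient.mk _) '' (G.edgesIn (liftSet s(x, y) W) \ {s(x, y)}) := by
  ext e
  constructor
  · intro he
    induction e with
    | h a b =>
      rw [mem_edgesIn] at he
      obtain ⟨⟨hne, u, v, huv, rfl, rfl⟩, ha, hb⟩ := he
      refine ⟨s(u, v), ⟨mem_edgesIn.2 ⟨huv, ha, hb⟩, fun h => hne ?_⟩, rfl⟩
      rw [Set.mem_singleton_iff, Sym2.eq_iff] at h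
      rw [mk_eq_mk]
      tauto
  · rintro ⟨e, ⟨he, hne⟩, rfl⟩
    induction e with
    | h u v =>
      rw [mem_edgesIn] at he
      rw [Sym2.map_mk, mem_edgesIn]
      refine ⟨⟨fun h => hne ?_, u, v, he.1, rfl, rfl⟩, he.2.1, he.2.2⟩
      rw [mk_eq_mk] at h
      have := he.1.ne
      rw [Set.mem_singleton_iff, Sym2.eq_iff]
      grind

variable [Finite V]

lemma ncard_edgesIn_contract_le {x y : V} (W : Set (Quotient (contractSetoid s(x, y)))) :
    ((G.contract s(x, y)).edgesIn W).ncard ≤ (G.edgesIn (liftSet s(x, y) W)).ncard := by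
  rw [edgesIn_contract]
  exact (Set.ncard_image_le (Set.toFinite _)).trans
    (Set.ncard_le_ncard Set.sdiff_subset (Set.toFinite _))

lemma ncard_edgesIn_contract_add_one_le {x y : V} (hxy : G.Adj x y)
    {W : Set (Quotient (contractSetoid s(x, y)))} (hx : x ∈ liftSet s(x, y) W) :
    ((G.contract s(x, y)).edgesIn W).ncard + 1 ≤ (G.edgesIn (liftSet s(x, y) W)).ncard := by
  rw [edgesIn_contract,
    ← Set.ncard_sdiff_singleton_add_one (mem_edgesIn.2 ⟨hxy, hx, mem_liftSet_comm.2 hx⟩)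
      (Set.toFinite _)]
  exact Nat.add_le_add_right (Set.ncard_image_le (Set.toFinite _)) 1

/-- The edge `xy` disappears and `yz` falls together with `xz`. Any other coincidence would come
from a second common neighbour of `x` and `y`. -/
lemma ncard_edgesIn_contract_add_two {x y z : V} (hxy : G.Adj x y) (hyz : G.Adj y z)
    (hzx : G.Adj z x) (huniq : ∀ c, G.Adj x c → G.Adj y c → c = z)
    {W : Set (Quotient (contractSetoid s(x, y)))} (hx : x ∈ liftSet s(x, y) W)
    (hz : z ∈ liftSet s(x, y) W) :
    ((G.contract s(x, y)).edgesIn W).ncard + 2 = (G.edgesIn (liftSet s(x, y) W)).ncard := by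
  have hy := mem_liftSet_comm.2 hx
  have hmem : s(x, y) ∈ G.edgesIn (liftSet s(x, y) W) := mem_edgesIn.2 ⟨hxy, hx, hy⟩
  have hne : s(y, z) ≠ s(x, y) := by
    rw [Ne, Sym2.eq_iff]
    have := hzx.ne
    have := hxy.ne
    grind
  have hmem' : s(y, z) ∈ G.edgesIn (liftSet s(x, y) W) \ {s(x, y)} :=
    ⟨mem_edgesIn.2 ⟨hyz, hy, hz⟩, hne⟩
  have himg : (G.contract s(x, y)).edgesIn W = Sym2.map (Quotient.mk _) ''
      ((G.edgesIn (liftSet s(x, y) W) \ {s(x, y)}) \ {s(y, z)}) := by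
    rw [edgesIn_contract]
    refine subset_antisymm ?_ (Set.image_mono Set.sdiff_subset)
    rintro _ ⟨e, he, rfl⟩
    by_cases heyz : e = s(y, z)
    · refine ⟨s(x, z), ⟨⟨mem_edgesIn.2 ⟨hzx.symm, hx, hz⟩, ?_⟩, ?_⟩, ?_⟩
      · rw [Set.mem_singleton_iff, Sym2.eq_iff]
        have := hyz.ne
        have := hzx.ne
        grind
      · rw [Set.mem_singleton_iff, Sym2.eq_iff]
        have := hxy.ne
        have := hzx.ne
        grind
      · rw [heyz, Sym2.map_mk, Sym2.map_mk, (mk_eq_mk (u := x) (v := y)).2 (by simp)]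
    · exact ⟨e, ⟨he, heyz⟩, rfl⟩
  have hinj : Set.InjOn (Sym2.map (Quotient.mk (contractSetoid s(x, y))))
      ((G.edgesIn (liftSet s(x, y) W) \ {s(x, y)}) \ {s(y, z)}) := by
    have core : ∀ a b c, G.Adj a b → G.Adj a c → s(a, b) ≠ s(y, z) → s(a, c) ≠ s(y, z) →
        (b = x ∨ b = y) → (c = x ∨ c = y) → b = c := by
      rintro a b c hab hac h1 h2 (rfl | rfl) (rfl | rfl)
      · rfl
      · exact absurd (by rw [huniq a hab.symm hac.symm, Sym2.eq_swap]) h2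
      · exact absurd (by rw [huniq a hac.symm hab.symm, Sym2.eq_swap]) h1
      · rfl
    have aux : ∀ a b c d, G.Adj a b → G.Adj c d → s(a, b) ≠ s(x, y) → s(a, b) ≠ s(y, z) →
        s(c, d) ≠ s(y, z) → (a = c ∨ ((a = x ∨ a = y) ∧ (c = x ∨ c = y))) →
        (b = d ∨ ((b = x ∨ b = y) ∧ (d = x ∨ d = y))) → s(a, b) = s(c, d) := by
      rintro a b c d hab hcd h1 h2 h3 (rfl | ⟨ha, hc⟩) (rfl | ⟨hb, hd⟩)
      · rfl
      · rw [core a b d hab hcd h2 h3 hb hd]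
      · rw [core b a c hab.symm hcd.symm (by rwa [Sym2.eq_swap]) (by rwa [Sym2.eq_swap]) ha hc]
      · refine absurd ?_ h1
        have := hab.ne
        rw [Sym2.eq_iff]
        grind
    intro e he f hf hef
    induction e with
    | h a b =>
      induction f with
      | h c d =>
        have h1 := (mem_edgesIn.1 he.1.1).1
        have h2 := (mem_edgesIn.1 hf.1.1).1
        rw [Sym2.map_mk, Sym2.map_mk, Sym2.eq_iff] at hef
        simp only [mk_eq_mk] at hef
        rcases hef with ⟨h3, h4⟩ | ⟨h3, h4⟩
        · exact aux a b c d h1 h2 he.1.2 he.2 hf.2 h3 h4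
        · rw [Sym2.eq_swap (a := c)]
          exact aux a b d c h1 h2.symm he.1.2 he.2 (by rw [Sym2.eq_swap]; exact hf.2) h3 h4
  rw [himg, hinj.ncard_image, ← Set.ncard_sdiff_singleton_add_one hmem (Set.toFinite _),
    ← Set.ncard_sdiff_singleton_add_one hmem' (Set.toFinite _)]

/-- An edge `xy` of a triangle `xyz` is contractible if no tight set other than `{x, y}`
contains `x` and `y` but not `z`. -/
theorem isContractible_of_blocker_eq (hG : G.IsIndependent) {x y z : V} (hxy : G.Adj x y)
    (hyz : G.Adj y z) (hzx : G.Adj z x) (h : ∀ W, G.IsBlocker x y z W → W = {x, y}) :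
    G.IsContractible s(x, y) := by
  -- Another common neighbour `c` would make `{x, y, c}` a blocker.
  have huniq : ∀ c, G.Adj x c → G.Adj y c → c = z := by
    intro c hxc hyc
    by_contra hcz
    have h3 : ({x, y, c} : Set V).ncard = 3 := by
      rw [Set.ncard_insert_of_notMem (by simp [hxy.ne, hxc.ne]), Set.ncard_pair hyc.ne]
    have hE : 3 ≤ (G.edgesIn {x, y, c}).ncard := by
      have : ({s(x, y), s(x, c), s(y, c)} : Set (Sym2 V)).ncard = 3 := by
        rw [Set.ncard_insert_of_notMem, Set.ncard_pair]
        · simp [hxy.ne, hxc.ne]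
        · simp only [Set.mem_insert_iff, Set.mem_singleton_iff, Sym2.eq_iff]
          have := hxy.ne
          have := hyc.ne
          have := hxc.ne
          grind
      rw [← this]
      refine Set.ncard_le_ncard ?_ (Set.toFinite _)
      rintro e (rfl | rfl | rfl) <;> rw [mem_edgesIn] <;> simp [hxy, hxc, hyc]
    have hT : G.IsTight {x, y, c} := by
      have := isIndependent_iff.1 hG {x, y, c} (by omega)
      refine ⟨by omega, ?_⟩
      rw [freedomOn] at this ⊢
      omega
    have := h _ ⟨hT, by simp, by simp, by simp [hzx.ne, hyz.ne.symm, Ne.symm hcz]⟩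
    have hc : c ∈ ({x, y, c} : Set V) := by simp
    rw [this] at hc
    simp [hxc.ne.symm, hyc.ne.symm] at hc
  have hcard : ∀ W : Set (Quotient (contractSetoid s(x, y))), x ∈ liftSet s(x, y) W →
      (liftSet s(x, y) W).ncard = W.ncard + 1 := fun W hx => by
    rw [← ncard_liftSet_diff hxy.ne, Set.ncard_sdiff_singleton_add_one (mem_liftSet_comm.2 hx)
      (Set.toFinite _)]
  refine ⟨hxy, isIndependent_iff.2 fun W hW => ?_, ?_⟩
  · by_cases hx : x ∈ liftSet s(x, y) W
    · have h1 := hcard W hx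
      have h2 := isIndependent_iff.1 hG (liftSet s(x, y) W) (by omega)
      by_cases hz : z ∈ liftSet s(x, y) W
      · have h3 := ncard_edgesIn_contract_add_two hxy hyz hzx huniq hx hz
        rw [freedomOn] at h2 ⊢
        omega
      · have h3 := ncard_edgesIn_contract_add_one_le hxy hx
        -- Here the freedom may drop by one, so it must have been positive: a tight lift would be a
        -- blocker, hence `{x, y}`, but the lift has at least three vertices.
        have h4 : G.freedomOn (liftSet s(x, y) W) ≠ 0 := by
          intro h0
          have := h _ ⟨⟨by omega, h0⟩, hx, mem_liftSet_comm.2 hx, hz⟩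
          rw [this, Set.ncard_pair hxy.ne] at h1
          omega
        rw [freedomOn] at h2 h4 ⊢
        omega
    · have h1 : (liftSet s(x, y) W).ncard = W.ncard := by
        rw [← ncard_liftSet_diff hxy.ne, Set.sdiff_singleton_eq_self (mt mem_liftSet_comm.1 hx)]
      have h2 := isIndependent_iff.1 hG (liftSet s(x, y) W) (by omega)
      have h3 := ncard_edgesIn_contract_le (G := G) W
      rw [freedomOn] at h2 ⊢
      omega
  · have h1 := hcard Set.univ trivial
    have h2 := ncard_edgesIn_contract_add_two hxy hyz hzx huniq (W := Set.univ) trivial trivial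
    have h3 : liftSet s(x, y) Set.univ = Set.univ := rfl
    rw [← freedomOn_univ, ← freedomOn_univ, freedomOn, freedomOn]
    rw [h3] at h1 h2
    omega

end Contract

/-! ### Contractible edges in maximal blockers -/

lemma IsTight.exists_triangle [Finite V] (hP : G.IsPlanar) {W : Set V} (hW : G.IsTight W)
    (h3 : 3 ≤ W.ncard) :
    ∃ a ∈ W, ∃ b ∈ W, ∃ c ∈ W, G.Adj a b ∧ G.Adj b c ∧ G.Adj c a := by
  have hE : (G.edgesIn W).ncard ≤ (G.induce W).edgeSet.ncard := by
    rw [← Set.ncard_image_of_injective _ (Sym2.map.injective Subtype.val_injective)]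
    refine Set.ncard_le_ncard ?_ (Set.toFinite _)
    intro e he
    induction e with
    | h u v =>
      rw [mem_edgesIn] at he
      exact ⟨s(⟨u, he.2.1⟩, ⟨v, he.2.2⟩), he.1, rfl⟩
  have h0 := hW.2
  rw [freedomOn] at h0
  obtain ⟨a, b, c, hab, hbc, hca⟩ := (hP.induce W).exists_triangle
    (by rwa [Nat.card_coe_set_eq]) (by rw [Nat.card_coe_set_eq]; omega)
  exact ⟨a, a.2, b, b.2, c, c.2, hab, hbc, hca⟩

section Main

variable [Finite V]

/-- A blocker of an edge of a triangle inside a maximal blocker `W` of `xy` lies in `W`, unless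
it contains `x` and `y`. -/
lemma IsBlocker.subset_of_maximal (hG : G.IsIndependent) {x y z : V} (hyz : G.Adj y z)
    (hzx : G.Adj z x) {W : Set V} (hW : Maximal (G.IsBlocker x y z) W) {a b c : V}
    (ha : a ∈ W) (hb : b ∈ W) (hab : G.Adj a b) {B : Set V} (hB : G.IsBlocker a b c B)
    (hxyB : ¬ (x ∈ B ∧ y ∈ B)) : B ⊆ W := by
  obtain ⟨hU, -, hno⟩ := hW.prop.1.union hG hB.1
    (two_le_ncard ⟨ha, hB.2.1⟩ ⟨hb, hB.2.2.1⟩ hab.ne)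
  have hz : z ∉ B := fun hz => hxyB
    ⟨(hno x hW.prop.2.1 z hz hzx.symm).resolve_right hW.prop.2.2.2,
      (hno y hW.prop.2.2.1 z hz hyz).resolve_right hW.prop.2.2.2⟩
  have : W ∪ B ⊆ W := hW.2 ⟨hU, Or.inl hW.prop.2.1, Or.inl hW.prop.2.2.1,
    fun h => h.elim hW.prop.2.2.2 hz⟩ Set.subset_union_left
  exact Set.subset_union_right.trans this

/-- A maximal blocker contains a contractible edge. -/
theorem exists_isContractible_of_maximal (hP : G.IsPlanar) (hG : G.IsIndependent) (n : ℕ) :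
    ∀ (x y z : V) (W : Set V), G.Adj x y → G.Adj y z → G.Adj z x →
      Maximal (G.IsBlocker x y z) W → W.ncard ≤ n → ∃ e ∈ G.edgesIn W, G.IsContractible e := by
  induction n with
  | zero =>
    intro x y z W _ _ _ hW hn
    have := hW.prop.1.1
    omega
  | succ n ih =>
    intro x y z W hxy hyz hzx hW hn
    have hsub : ({x, y} : Set V) ⊆ W :=
      Set.insert_subset hW.prop.2.1 (Set.singleton_subset_iff.2 hW.prop.2.2.1)
    by_cases h2 : W.ncard ≤ 2
    · have hWxy : {x, y} = W :=
        Set.eq_of_subset_of_ncard_le hsub (by rwa [Set.ncard_pair hxy.ne]) (Set.toFinite _)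
      refine ⟨s(x, y), mem_edgesIn.2 ⟨hxy, hW.prop.2.1, hW.prop.2.2.1⟩,
        isContractible_of_blocker_eq hG hxy hyz hzx fun B hB => ?_⟩
      -- Every blocker of `xy` contains `{x, y} = W`, so maximality makes it equal to `W`.
      have hWB : W ⊆ B := hWxy ▸
        Set.insert_subset hB.2.1 (Set.singleton_subset_iff.2 hB.2.2.1)
      exact (subset_antisymm (hW.2 hB hWB) hWB).trans hWxy.symm
    · obtain ⟨a, ha, b, hb, c, hc, hab, hbc, hca⟩ :=
        hW.prop.1.exists_triangle hP (by omega)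
      -- A maximal blocker `B` of `ab` lies in `W` and misses `c`, so it is smaller. It is maximal
      -- among all blockers in `G`, as the induction hypothesis requires.
      have step : ∀ a b c : V, b ∈ W → a ∈ W → c ∈ W → G.Adj a b → G.Adj b c → G.Adj c a →
          (∀ B, G.IsBlocker a b c B → ¬ (x ∈ B ∧ y ∈ B)) →
          ∃ e ∈ G.edgesIn W, G.IsContractible e := by
        intro a b c hb ha hc hab hbc hca hgood
        obtain ⟨B, hB⟩ := exists_maximal_blocker hG hab hbc hca
        have hBW := hB.prop.subset_of_maximal hG hyz hzx hW ha hb hab (hgood B hB.prop)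
        have hlt : B.ncard < W.ncard :=
          Set.ncard_lt_ncard ⟨hBW, fun h => hB.prop.2.2.2 (h hc)⟩ (Set.toFinite _)
        obtain ⟨e, he, hce⟩ := ih a b c B hab hbc hca hB (by omega)
        exact ⟨e, edgesIn_mono hBW he, hce⟩
      by_cases hgood : ∀ B, G.IsBlocker a b c B → ¬ (x ∈ B ∧ y ∈ B)
      · exact step a b c hb ha hc hab hbc hca hgood
      · push Not at hgood
        obtain ⟨A, hA, hxA, hyA⟩ := hgood
        -- If a blocker of `ab` contains `x` and `y`, no blocker of `bc` does, since the two meet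
        -- only in `b`.
        refine step b c a hc hb ha hbc hca hab fun B hB hxyB => ?_
        have hAB := hA.inter hG hca hB
        have h1 : x ∈ A ∩ B := ⟨hxA, hxyB.1⟩
        have h2 : y ∈ A ∩ B := ⟨hyA, hxyB.2⟩
        rw [hAB] at h1 h2
        exact hxy.ne (h1.trans h2.symm)

lemma exists_blocker_isContractible (hP : G.IsPlanar) (hG : G.IsIndependent) {x y z : V}
    (hxy : G.Adj x y) (hyz : G.Adj y z) (hzx : G.Adj z x) :
    ∃ W, G.IsBlocker x y z W ∧ ∃ e ∈ G.edgesIn W, G.IsContractible e := by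
  obtain ⟨W, hW⟩ := exists_maximal_blocker hG hxy hyz hzx
  exact ⟨W, hW.prop, exists_isContractible_of_maximal hP hG _ x y z W hxy hyz hzx hW le_rfl⟩

end Main

end SimpleGraph

theorem corollary4p12 {V : Type*} [Finite V] (G : SimpleGraph V) (hG : G.IsPlanar) :
    (G.IsMaximallyIndependent → 2 < Nat.card V →
      3 ≤ {e : Sym2 V | G.IsContractible e}.ncard) ∧
    (G.IsIndependent → ∀ x y z : V, G.Adj x y → G.Adj y z → G.Adj z x →
      ∃ Rxy Ryz Rzx : G.Subgraph,
        (Rxy.coe.IsMaximallyIndependent ∧ x ∈ Rxy.verts ∧ y ∈ Rxy.verts ∧ z ∉ Rxy.verts ∧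
          ∃ e ∈ Rxy.edgeSet, G.IsContractible e) ∧
        (Ryz.coe.IsMaximallyIndependent ∧ y ∈ Ryz.verts ∧ z ∈ Ryz.verts ∧ x ∉ Ryz.verts ∧
          ∃ e ∈ Ryz.edgeSet, G.IsContractible e) ∧
        (Rzx.coe.IsMaximallyIndependent ∧ z ∈ Rzx.verts ∧ x ∈ Rzx.verts ∧ y ∉ Rzx.verts ∧
          ∃ e ∈ Rzx.edgeSet, G.IsContractible e) ∧
        Rxy.verts ∩ Ryz.verts = {y} ∧ Ryz.verts ∩ Rzx.verts = {z} ∧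
        Rzx.verts ∩ Rxy.verts = {x}) := by
  constructor
  · intro hM h2
    have hT : G.IsTight Set.univ :=
      ⟨by rw [Set.ncard_univ]; omega, by rw [SimpleGraph.freedomOn_univ, hM.2]⟩
    obtain ⟨x, -, y, -, z, -, hxy, hyz, hzx⟩ :=
      hT.exists_triangle hG (by rw [Set.ncard_univ]; omega)
    obtain ⟨A, hA, e, he, hce⟩ := SimpleGraph.exists_blocker_isContractible hG hM.1 hxy hyz hzx
    obtain ⟨B, hB, f, hf, hcf⟩ := SimpleGraph.exists_blocker_isContractible hG hM.1 hyz hzx hxy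
    obtain ⟨C, hC, g, hg, hcg⟩ := SimpleGraph.exists_blocker_isContractible hG hM.1 hzx hxy hyz
    -- The blockers meet pairwise in one vertex and hence share no edge.
    have hef := SimpleGraph.ne_of_mem_edgesIn (hA.inter hM.1 hzx hB) he hf
    have hfg := SimpleGraph.ne_of_mem_edgesIn (hB.inter hM.1 hxy hC) hf hg
    have hge := SimpleGraph.ne_of_mem_edgesIn (hC.inter hM.1 hyz hA) hg he
    have h3 : ({e, f, g} : Set (Sym2 V)).ncard = 3 := by
      rw [Set.ncard_insert_of_notMem (by simp [hef, hge.symm]), Set.ncard_pair hfg]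
    rw [← h3]
    refine Set.ncard_le_ncard ?_ (Set.toFinite _)
    rintro _ (rfl | rfl | rfl) <;> assumption
  · intro hI x y z hxy hyz hzx
    obtain ⟨A, hA, e, he, hce⟩ := SimpleGraph.exists_blocker_isContractible hG hI hxy hyz hzx
    obtain ⟨B, hB, f, hf, hcf⟩ := SimpleGraph.exists_blocker_isContractible hG hI hyz hzx hxy
    obtain ⟨C, hC, g, hg, hcg⟩ := SimpleGraph.exists_blocker_isContractible hG hI hzx hxy hyz
    rw [SimpleGraph.edgesIn_eq_induce] at he hf hg
    -- The subgraphs are those induced by `A`, `B` and `C`.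
    exact ⟨_, _, _,
      ⟨hA.1.isMaximallyIndependent hI, hA.2.1, hA.2.2.1, hA.2.2.2, e, he, hce⟩,
      ⟨hB.1.isMaximallyIndependent hI, hB.2.1, hB.2.2.1, hB.2.2.2, f, hf, hcf⟩,
      ⟨hC.1.isMaximallyIndependent hI, hC.2.1, hC.2.2.1, hC.2.2.2, g, hg, hcg⟩,
      hA.inter hI hzx hB, hB.inter hI hxy hC, hC.inter hI hyz hA⟩
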